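/- Let $W=\langle s,t\mid s^2=t^2=1\rangle$ be the infinite dihedral group, let $G\cong\mathbb Z$ be the subgroup generated by $st$, and let $\mathbf q=(q_s,q_t)$ with $q_s,q_t>0$. Let $\mathbb R_{\mathbf q}W$ be the Hecke algebra, with basis $(T_w)_{w\in W}$ and $T_wT_u=T_{wu}$ if $|wu|>|w|$, $T_wT_u=(q_u-1)T_w+q_uT_{wu}$ if $|wu|<|w|$, for $u\in\{s,t\}$. Let $L^2_{\mathbf q}W$ be its Hilbert space completion for $\langle T_w,T_{w'}\rangle_{\mathbf q}=q^w\delta_{w,w'}$, where $q^w$ is the product of the parameters $q_u$ over the letters $u$ of a reduced expression of $w$. The group algebra $\mathbb RW$ acts on $L^2_{\mathbf q}W$ by right multiplication through the algebra isomorphism $\mathbb RW\to\mathbb R_{\mathbf q}W$, $u\mapsto\frac{1-q_u}{1+q_u}+\frac{2}{1+q_u}T_u$ ($u\in\{s,t\}$). For an $m\times n$ matrix $M$ over $\mathbb RW$ let $M_{\mathbf q}$ be its image over $\mathbb R_{\mathbf q}W$ and $R_{M_{\mathbf q}}:(L^2_{\mathbf q}W)^m\to(L^2_{\mathbf q}W)^n$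 right multiplication by it. For a closed left-invariant subspace $V\subseteq(L^2_{\mathbf q}W)^m$ put $\dim_W^{\mathbf q}V=\sum_{i}\langle \mathrm{pr}_V\epsilon_i,\epsilon_i\rangle_{\mathbf q}$, where $\epsilon_i$ is the vector with $1=T_1$ in position $i$ and $0$ elsewhere and $\mathrm{pr}_V$ is the orthogonal projection onto $V$. Let $L^2_{\mathbf q}G$ be the closure of $\mathbb RG$ in $L^2_{\mathbf q}W$, and for a closed $G$-invariant subspace $V\subseteq L^2_{\mathbf q}G$ put $\dim_G^{\mathbf q}V=\langle\mathrm{pr}_V 1,1\rangle_{\mathbf q}$. Let $K_+$, $K_-$ be the $+1$- and $-1$-eigenspaces of right multiplication by $st$ on $L^2_{\mathbf q}G$, and $K_\emptyset$ the orthogonal complement of $K_+\oplus K_-$ in $L^2_{\mathbf q}G$. Fix a matrix $M$ over $\mathbb RW$. Then $\dim_W^{\mathbf q}\ker R_{M_{\mathbf q}}$ is a continuous, piecewise-rational function of $(q_s,q_t)\in(0,\infty)^2$, with breaks only along the curves $q_s=q_t$ and $q_sq_t=1$: on each of the four closed regions into which these curves divide $(0,\infty)^2$ it is given by a single rational function without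 poles there. More precisely, there are nonnegative integers $a,a',b,b',c$ depending only on $M$ (not on $\mathbf q$) such that for all $\mathbf q$ $$\dim_W^{\mathbf q}\ker R_{M_{\mathbf q}}=a_{\mathbf q}\dim_G^{\mathbf q}K_+ + b_{\mathbf q}\dim_G^{\mathbf q}K_- + \frac c2\dim_G^{\mathbf q}K_\emptyset,$$ where $a_{\mathbf q}=a$ if $q_sq_t<1$ and $a_{\mathbf q}=a'$ otherwise, and $b_{\mathbf q}=b$ if $q_s<q_t$ and $b_{\mathbf q}=b'$ otherwise. -/

import Mathlib

noncomputable section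

namespace HeckeDihedral

open scoped ENNReal

/-! ### The infinite dihedral group -/

/-- The infinite dihedral group `⟨s, t ∣ s² = t² = 1⟩`. -/
abbrev W : Type := DihedralGroup 0

/-- The two standard generators: `gen 0` is `s` and `gen 1` is `t`. -/
def gen (i : Fin 2) : W := DihedralGroup.sr ((i : ℕ) : ℤ)

/-- The number of occurrences of the generator `gen i` in the reduced expression of `w`.
With `s = sr 0` and `t = sr 1` one has, for `k ≥ 0`,
`r k = (st)^k`, `r (-k) = (ts)^k`, `sr (-k) = (st)^k s` and `sr (k+1) = (ts)^k t`. -/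
def letters (i : Fin 2) : W → ℕ
  | .r k => (show ℤ from k).natAbs
  | .sr k => ((show ℤ from k) - 1 + ((i : ℕ) : ℤ)).natAbs

/-- Word length with respect to `s, t`. -/
def length (w : W) : ℕ := letters 0 w + letters 1 w

/-- The subgroup generated by `st`. -/
def G : Subgroup W := Subgroup.zpowers (gen 0 * gen 1)

/-- Deformation parameters `q = (q_s, q_t)`, `q_s, q_t > 0`: `q 0` is `q_s`, `q 1` is `q_t`. -/
abbrev Param : Type := Fin 2 → {x : ℝ // 0 < x}

/-- `q^w`. -/
def qpow (q : Param) (w : W) : ℝ := (q 0 : ℝ) ^ letters 0 w * (q 1 : ℝ) ^ letters 1 w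

/-! ### The Hilbert space `L²_q W` and the right action of the Hecke generators

`L²_q W` is the Hilbert space with orthogonal basis `T_w` and `⟨T_w, T_w⟩ = q^w`. It is written
in the coordinates of the orthonormal basis `T_w / √(q^w)`, so that as a Hilbert space it is
`ℓ²(W)`; the parameter enters through the vectors `T_w` and through the multiplication. -/

/-- The Hilbert space `L²_q W`, in coordinates with respect to `T_w / √(q^w)`. -/
abbrev L2 : Type := lp (fun _ : W => ℝ) 2

/-- The vector `T_w` of `L²_q W`, with `⟨T_w, T_w⟩ = q^w`. -/
def T (q : Param) (w : W) : L2 := lp.single 2 w (Real.sqrt (qpow q w))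

/-- The unit element `1 = T_1` of `L²_q W`. -/
def one (q : Param) : L2 := T q 1

theorem memlp_comp_mul (g : W) (f : L2) : Memℓp (fun w : W => f (w * g)) 2 := by
  have h := (memℓp_gen_iff (p := 2) (by norm_num)).1 (lp.memℓp f)
  exact (memℓp_gen_iff (p := 2) (by norm_num)).2
    ((Equiv.mulRight g).summable_iff.2 h)

/-- The coordinate permutation `f ↦ (w ↦ f (w g))`. -/
def shift (g : W) : L2 →L[ℝ] L2 :=
  LinearMap.mkContinuous
    { toFun := fun f => ⟨fun w => f (w * g), memlp_comp_mul g f⟩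
      map_add' := fun _ _ => rfl
      map_smul' := fun _ _ => rfl } 1 (by
    intro f
    rw [one_mul, lp.norm_eq_tsum_rpow (by norm_num), lp.norm_eq_tsum_rpow (by norm_num)]
    exact le_of_eq (congrArg (· ^ _)
      ((Equiv.mulRight g).tsum_eq (fun w => ‖f w‖ ^ (2 : ℝ≥0∞).toReal))))

open scoped Classical in
/-- Restriction of the coordinates to the set `D`. -/
def restrict (D : Set W) : L2 →L[ℝ] L2 :=
  LinearMap.mkContinuous
    { toFun := fun f => ⟨fun w => if w ∈ D then f w else 0,
        (lp.memℓp f).mono' (fun w => by split_ifs <;> simp)⟩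
      map_add' := fun f g => by
        ext w
        change (if w ∈ D then f w + g w else 0)
          = (if w ∈ D then f w else 0) + (if w ∈ D then g w else 0)
        split_ifs <;> simp
      map_smul' := fun c f => by
        ext w
        by_cases h : w ∈ D <;> simp [h] } 1 (by
    intro f
    rw [one_mul]
    refine lp.norm_mono (by norm_num) (fun w => ?_)
    change ‖if w ∈ D then f w else 0‖ ≤ ‖f w‖
    split_ifs <;> simp)

/-- The elements `w` with `|w gen i| < |w|`. -/
def descents (i : Fin 2) : Set W := {w | length (w * gen i) < length w}

/-- Right multiplication by the Hecke generator `T_{gen i}` on `L²_q W`: in the coordinates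
with respect to `T_w / √(q^w)` it is the operator below; on the vectors `T_w` it is given by the
Hecke multiplication formulas, see `heckeRight_T`. -/
def heckeRight (q : Param) (i : Fin 2) : L2 →L[ℝ] L2 :=
  Real.sqrt (q i) • shift (gen i) + ((q i : ℝ) - 1) • restrict (descents i)

theorem gen_mul_self (i : Fin 2) : gen i * gen i = 1 := DihedralGroup.sr_mul_self _

theorem letters_mul_gen (i : Fin 2) (w : W) :
    (length w < length (w * gen i) ∧
      ∀ j, letters j (w * gen i) = letters j w + (if i = j then 1 else 0)) ∨
    (length (w * gen i) < length w ∧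
      ∀ j, letters j w = letters j (w * gen i) + (if i = j then 1 else 0)) := by
  rcases w with k | k
  · change ℤ at k
    have h : ∀ j, letters j (DihedralGroup.r k * gen i : W)
        = (((i : ℕ) : ℤ) - k - 1 + ((j : ℕ) : ℤ)).natAbs := fun j => rfl
    have h' : ∀ j, letters j (DihedralGroup.r k : W) = k.natAbs := fun j => rfl
    simp only [length, Fin.forall_fin_two, h, h']
    fin_cases i <;> simp <;> omega
  · change ℤ at k
    have h : ∀ j, letters j (DihedralGroup.sr k * gen i : W)
        = (((i : ℕ) : ℤ) - k).natAbs := fun j => rfl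
    have h' : ∀ j, letters j (DihedralGroup.sr k : W)
        = (k - 1 + ((j : ℕ) : ℤ)).natAbs := fun j => rfl
    simp only [length, Fin.forall_fin_two, h, h']
    fin_cases i <;> simp <;> omega

theorem qpow_pos (q : Param) (w : W) : 0 < qpow q w :=
  mul_pos (pow_pos (q 0).2 _) (pow_pos (q 1).2 _)

theorem inner_T (q : Param) (v w : W) :
    inner ℝ (T q v) (T q w) = if v = w then qpow q w else 0 := by
  rw [T, lp.inner_single_left]
  by_cases h : v = w
  · subst h
    simp [T, Real.sq_sqrt (qpow_pos q v).le]
  · simp [T, h, lp.single_apply]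

theorem qpow_eq_mul {q : Param} {i : Fin 2} {v w : W}
    (h : ∀ j, letters j v = letters j w + (if i = j then 1 else 0)) :
    qpow q v = q i * qpow q w := by
  unfold qpow
  rw [h 0, h 1]
  fin_cases i <;> simp [pow_succ] <;> ring

theorem heckeRight_apply (q : Param) (i : Fin 2) (f : L2) (w : W) :
    heckeRight q i f w = Real.sqrt (q i) * f (w * gen i)
      + ((q i : ℝ) - 1) * (open scoped Classical in if w ∈ descents i then f w else 0) := rfl

/-- The Hecke multiplication formulas
`T_w T_s = T_{ws}` if `|ws| > |w|` and `T_w T_s = (q_s - 1) T_w + q_s T_{ws}` if `|ws| < |w|`. -/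
theorem heckeRight_T (q : Param) (i : Fin 2) (w : W) :
    heckeRight q i (T q w) = if length w < length (w * gen i) then T q (w * gen i)
      else ((q i : ℝ) - 1) • T q w + (q i : ℝ) • T q (w * gen i) := by
  have hinv : ∀ v : W, v * gen i = w ↔ v = w * gen i := fun v => by
    constructor <;> rintro rfl <;> rw [mul_assoc, gen_mul_self, mul_one]
  have hne : w * gen i ≠ w := fun h => by
    rcases letters_mul_gen i w with h' | h' <;> simp [h] at h'
  have hs : Real.sqrt (q i) * Real.sqrt (q i) = q i := Real.mul_self_sqrt (q i).2.le
  have hT : ∀ v u : W, T q v u = if u = v then Real.sqrt (qpow q v) else 0 := fun v u => by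
    simp [T, lp.single_apply, Pi.single_apply]
  ext v
  rw [heckeRight_apply]
  rcases letters_mul_gen i w with ⟨h1, h2⟩ | ⟨h1, h2⟩
  · rw [if_pos h1, hT, hT, hT, qpow_eq_mul h2, Real.sqrt_mul (q i).2.le]
    have hd : w ∉ descents i := by simp only [descents, Set.mem_ofPred_eq]; omega
    simp only [hinv]
    by_cases hv : v = w
    · subst hv; simp [hd, hne.symm]
    · simp [hv]
  · rw [if_neg (not_lt.2 h1.le)]
    have hd : w ∈ descents i := h1
    have hq : Real.sqrt (qpow q w) = Real.sqrt (q i) * Real.sqrt (qpow q (w * gen i)) := by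
      rw [qpow_eq_mul h2, Real.sqrt_mul (q i).2.le]
    change _ = ((q i : ℝ) - 1) * T q w v + (q i : ℝ) * T q (w * gen i) v
    rw [hT, hT, hT, hq]
    simp only [hinv]
    by_cases hv : v = w
    · subst hv; simp [hd, hne.symm]
    · by_cases hv' : v = w * gen i
      · subst hv'
        simp only [hne, if_true, if_false, ite_self, mul_zero, add_zero, zero_add, ← mul_assoc, hs]
      · simp [hv, hv']

/-- The quadratic relation `T_s² = (q_s - 1) T_s + q_s`. -/
theorem heckeRight_sq (q : Param) (i : Fin 2) :
    heckeRight q i * heckeRight q i = ((q i : ℝ) - 1) • heckeRight q i + (q i : ℝ) • 1 := by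
  have hs : Real.sqrt (q i) * Real.sqrt (q i) = q i := Real.mul_self_sqrt (q i).2.le
  ext f w
  change heckeRight q i (heckeRight q i f) w
    = ((q i : ℝ) - 1) * heckeRight q i f w + (q i : ℝ) * f w
  have hww : w * gen i * gen i = w := by rw [mul_assoc, gen_mul_self, mul_one]
  rw [heckeRight_apply q i (heckeRight q i f), heckeRight_apply, heckeRight_apply, hww]
  rcases letters_mul_gen i w with ⟨h1, -⟩ | ⟨h1, -⟩
  · have hd : w ∉ descents i := by simp only [descents, Set.mem_ofPred_eq]; omega
    have hd' : w * gen i ∈ descents i := by simpa only [descents, Set.mem_ofPred_eq, hww] using h1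
    simp only [hd, hd', if_true, if_false]
    linear_combination f w * hs
  · have hd : w ∈ descents i := h1
    have hd' : w * gen i ∉ descents i := by
      simp only [descents, Set.mem_ofPred_eq, hww]; omega
    simp only [hd, hd', if_true, if_false]
    linear_combination f w * hs

/-! ### The right action of the group algebra

The canonical isomorphism from the group algebra to the Hecke algebra sends `s` to
`(1 - q_s)/(1 + q_s) + 2/(1 + q_s) T_s`, for both generators. -/

/-- Right multiplication on `L²_q W` by the image
`(1 - q_s)/(1 + q_s) + 2/(1 + q_s) T_s` of a generator. -/
def genRight (q : Param) (i : Fin 2) : L2 →L[ℝ] L2 :=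
  ((1 - (q i : ℝ)) / (1 + q i)) • 1 + (2 / (1 + (q i : ℝ))) • heckeRight q i

theorem genRight_mul_self (q : Param) (i : Fin 2) : genRight q i * genRight q i = 1 := by
  have h0 : (1 + (q i : ℝ)) ≠ 0 := by have := (q i).2; positivity
  have hq := heckeRight_sq q i
  simp only [genRight, mul_add, add_mul, smul_mul_assoc, mul_smul_comm, one_mul, mul_one, hq,
    smul_add, smul_smul]
  have e : ∀ (X : L2 →L[ℝ] L2) (a b c d e' : ℝ), a + e' = 1 → b + c + d = 0 →
      a • (1 : L2 →L[ℝ] L2) + b • X + (c • X + (d • X + e' • (1 : L2 →L[ℝ] L2))) = 1 := by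
    intro X a b c d e' h1 h2
    have : a • (1 : L2 →L[ℝ] L2) + b • X + (c • X + (d • X + e' • (1 : L2 →L[ℝ] L2)))
        = (a + e') • (1 : L2 →L[ℝ] L2) + (b + c + d) • X := by module
    rw [this, h1, h2]; simp
  apply e <;> field_simp <;> ring

/-- Two involutions of a monoid define a homomorphism from the infinite dihedral group:
`r k ↦ (ab)^k`, `sr k ↦ a (ab)^k`. -/
def dihedralLift {A : Type*} [Monoid A] (a b : A) (ha : a * a = 1) (hb : b * b = 1) : W →* A :=
  let u : Aˣ := ⟨a, a, ha, ha⟩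
  let v : Aˣ := ⟨b, b, hb, hb⟩
  (Units.coeHom A).comp
    { toFun := fun w => match w with
        | .r k => (u * v) ^ (show ℤ from k)
        | .sr k => u * (u * v) ^ (show ℤ from k)
      map_one' := zpow_zero _
      map_mul' := by
        have hu : u * u = 1 := Units.ext ha
        have hv : v * v = 1 := Units.ext hb
        have hui : u⁻¹ = u := rfl
        have hconj : ∀ k : ℤ, u * (u * v) ^ k * u = (u * v) ^ (-k) := fun k => by
          have h1 := conj_zpow (i := k) (a := u) (b := u * v)
          rw [hui] at h1
          rw [← h1, zpow_neg, ← inv_zpow]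
          congr 1
          rw [mul_inv_rev, ← mul_assoc u u v, hu, one_mul]
          rfl
        have hcomm : ∀ k : ℤ, (u * v) ^ k * u = u * (u * v) ^ (-k) := fun k => by
          rw [← hconj, ← mul_assoc, ← mul_assoc, hu, one_mul]
        rintro (k | k) (l | l) <;> change ℤ at k <;> change ℤ at l
        · exact zpow_add (u * v) k l
        · change u * (u * v) ^ (l - k) = (u * v) ^ k * (u * (u * v) ^ l)
          rw [← mul_assoc, hcomm, mul_assoc, ← zpow_add]
          congr 2; ring
        · change u * (u * v) ^ (k + l) = u * (u * v) ^ k * (u * v) ^ l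
          rw [mul_assoc, ← zpow_add]
        · change (u * v) ^ (l - k) = u * (u * v) ^ k * (u * (u * v) ^ l)
          rw [← mul_assoc, hconj, ← zpow_add]
          congr 1; ring }

theorem dihedralLift_gen_zero {A : Type*} [Monoid A] (a b : A) (ha : a * a = 1)
    (hb : b * b = 1) : dihedralLift a b ha hb (gen 0) = a := by
  let u : Aˣ := ⟨a, a, ha, ha⟩
  let v : Aˣ := ⟨b, b, hb, hb⟩
  change ((u * (u * v) ^ (0 : ℤ) : Aˣ) : A) = a
  rw [zpow_zero, mul_one]

theorem dihedralLift_gen_one {A : Type*} [Monoid A] (a b : A) (ha : a * a = 1)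
    (hb : b * b = 1) : dihedralLift a b ha hb (gen 1) = b := by
  let u : Aˣ := ⟨a, a, ha, ha⟩
  let v : Aˣ := ⟨b, b, hb, hb⟩
  change ((u * (u * v) ^ (1 : ℤ) : Aˣ) : A) = b
  have hu : u * u = 1 := Units.ext ha
  rw [zpow_one, ← mul_assoc, hu, one_mul]

/-- The right action of the group algebra `ℝ W` on `L²_q W` (an algebra homomorphism to the
opposite of the algebra of bounded operators): `rightMul q y` is right multiplication by the
image of `y` in the Hecke algebra. -/
def rightMul (q : Param) : MonoidAlgebra ℝ W →ₐ[ℝ] (L2 →L[ℝ] L2)ᵐᵒᵖ :=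
  MonoidAlgebra.lift ℝ (L2 →L[ℝ] L2)ᵐᵒᵖ W
    (dihedralLift (MulOpposite.op (genRight q 0)) (MulOpposite.op (genRight q 1))
      (by rw [← MulOpposite.op_mul, genRight_mul_self, MulOpposite.op_one])
      (by rw [← MulOpposite.op_mul, genRight_mul_self, MulOpposite.op_one]))

/-- The bounded operator `x ↦ x y` on `L²_q W`, for `y` in the group algebra. -/
def R (q : Param) (y : MonoidAlgebra ℝ W) : L2 →L[ℝ] L2 := (rightMul q y).unop

theorem R_gen (q : Param) (i : Fin 2) :
    R q (MonoidAlgebra.of ℝ W (gen i)) = genRight q i := by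
  rw [R, rightMul, MonoidAlgebra.lift_of]
  fin_cases i
  · exact congrArg MulOpposite.unop (dihedralLift_gen_zero _ _ _ _)
  · exact congrArg MulOpposite.unop (dihedralLift_gen_one _ _ _ _)

/-- Right multiplication `(L²_q W)^m → (L²_q W)^n` by an `m × n` matrix over `ℝ W`:
`(x M)_j = ∑ i, x_i M_{ij}`. -/
def RMat (q : Param) {m n : ℕ} (M : Matrix (Fin m) (Fin n) (MonoidAlgebra ℝ W)) :
    PiLp 2 (fun _ : Fin m => L2) →L[ℝ] PiLp 2 (fun _ : Fin n => L2) :=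
  (PiLp.continuousLinearEquiv 2 ℝ (fun _ : Fin n => L2)).symm.toContinuousLinearMap.comp
    (ContinuousLinearMap.pi fun j => ∑ i, (R q (M i j)).comp (PiLp.proj 2 (fun _ : Fin m => L2) i))

/-! ### Von Neumann dimensions -/

/-- The standard basis vector `ε_i = (0, …, 0, 1, 0, …, 0)` of `(L²_q W)^m`. -/
def stdVec (q : Param) {m : ℕ} (i : Fin m) : PiLp 2 (fun _ : Fin m => L2) :=
  WithLp.toLp 2 (Pi.single i (one q))

/-- The von Neumann dimension `∑ i, ⟨pr_V ε_i, ε_i⟩` of a closed subspace `V` of `(L²_q W)^m`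
(a Hilbert module when `V` is invariant under left multiplication). -/
def dimW (q : Param) {m : ℕ} (V : Submodule ℝ (PiLp 2 (fun _ : Fin m => L2)))
    [V.HasOrthogonalProjection] : ℝ :=
  ∑ i, inner ℝ (V.starProjection (stdVec q i)) (stdVec q i)

/-- `L²_q G`: the closure of the group algebra of `G` in `L²_q W`. -/
abbrev L2G (q : Param) : Submodule ℝ L2 :=
  (Submodule.span ℝ {x | ∃ g ∈ G, x = R q (MonoidAlgebra.of ℝ W g) (one q)}).topologicalClosure

/-- The unit element `1` of `L²_q G`. -/
def oneG (q : Param) : L2G q :=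
  ⟨one q, Submodule.le_topologicalClosure _ (Submodule.subset_span
    ⟨1, G.one_mem, by rw [R, map_one, map_one]; rfl⟩)⟩

/-- The von Neumann dimension `⟨pr_V 1, 1⟩` of a closed subspace `V` of `L²_q G`. -/
def dimG (q : Param) (V : Submodule ℝ (L2G q)) [V.HasOrthogonalProjection] : ℝ :=
  inner ℝ (V.starProjection (oneG q)) (oneG q)

/-- The element `st` of the group algebra. -/
def st : MonoidAlgebra ℝ W := MonoidAlgebra.of ℝ W (gen 0 * gen 1)

/-- The eigenspace of right multiplication by `st` on `L²_q G` for the real eigenvalue `c`. -/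
abbrev K (q : Param) (c : ℝ) : Submodule ℝ (L2G q) :=
  ((R q st - c • 1).comp (L2G q).subtypeL : L2G q →L[ℝ] L2).ker

/-- The orthogonal complement in `L²_q G` of the sum of the `1`- and `-1`-eigenspaces. -/
abbrev Kempty (q : Param) : Submodule ℝ (L2G q) := (K q 1 ⊔ K q (-1))ᗮ

instance (q : Param) : (Kempty q).HasOrthogonalProjection :=
  haveI : CompleteSpace (Kempty q) := Submodule.instOrthogonalCompleteSpace _
  .ofCompleteSpace _

/-- `dim ker R_M` as a function of `q`. -/
def dimKer {m n : ℕ} (M : Matrix (Fin m) (Fin n) (MonoidAlgebra ℝ W)) (q : Param) : ℝ :=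
  dimW q ((RMat q M).ker)

/-- On the set `A` of parameters, `f` is given by a single rational function of `(q_s, q_t)`,
without poles on `A`. -/
def RationalOn (f : Param → ℝ) (A : Set Param) : Prop :=
  ∃ P Q : MvPolynomial (Fin 2) ℝ, ∀ q ∈ A,
    MvPolynomial.eval (fun i => (q i : ℝ)) Q ≠ 0 ∧
    f q = MvPolynomial.eval (fun i => (q i : ℝ)) P / MvPolynomial.eval (fun i => (q i : ℝ)) Q

end HeckeDihedral

end

/-!
The operators `S`, `T` of right multiplication by `s`, `t` are self-adjoint involutions of
`L²_q W`, so `W` acts unitarily. The element `z = st + ts` is central in `ℝW`, and `ℝW` is free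
over `ℝ[z]` with basis `1, s, t, st`; it embeds into the `2 × 2` matrices over `ℝ[z]`
(`theta_injective`), and the matrix trace restricts to the reduced trace.

*The Hilbert space.* `L²_q W` splits into the eigenspaces of the four characters of `W`
(`charSpace`) and a complement (`contSpace`). On the complement `z` has no eigenvalues: a vector
`v` with `S v = ± v` and `z v = a v` amounts to two square summable solutions of a second order
recursion on half-lines, and the conditions for gluing them at `1` force `a = ± 2`
(`energy_of_decaying_solution`, `eigenvalue_sq_of_gen_eigenvector`). Hence nonzero polynomials in
`z` are injective on `contSpace`, and identities there may be checked after multiplication by such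
a polynomial (`inner_eq_zero_of_forall_fZ`). Applied to `z² - 4` this shows that the trace given by
the component of `1` in `contSpace` vanishes on `s ℝ[z]` and `t ℝ[z]`, so that it is half of the
reduced trace (`contTrace_eq`); that it is a trace at all comes from left multiplication.
Evaluating the traces of `s` and `t` gives two linear relations between the dimensions `charDim` of
the four eigenspaces. Of two characters that agree up to sign, at most one has square summable
eigenvectors, and the relations then determine all four (`charDim_sub_charDim`).

*The kernel.* The kernel of `M` is that of the self-adjoint matrix `B = M M*`. Its reduced
characteristic polynomial is `X ^ k * g` with `p = g 0 ≠ 0` in `ℝ[z]`. For every `q` the operator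
of `g B` is `p` times the orthogonal projection onto the kernel (`RMat_aeval_eq`), and the reduced
trace of `g B` is `c p` for a natural number `c` that depends only on `B`
(`exists_polynomial_of_matrix`). So `contSpace` contributes `c / 2` times its dimension. The
eigenspace of a character `χ` contributes its dimension times the nullity of the real matrix `χ M`
(`starProjection_tens`).

*The subgroup.* The `± 1`-eigenspaces of `st` are spanned by the eigenspaces of the characters with
that value at `st`, and the mean ergodic theorem places the corresponding components of `1` in
`L²_q G` (`stPart_mem_L2G`).
-/

noncomputable section

namespace HeckeDihedral

open scoped ENNReal
open Polynomial Filter Topology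

/-! ### The group algebra over its centre -/

/-- The generator `gen i` as an element of the group algebra. -/
def gA (i : Fin 2) : MonoidAlgebra ℝ W := MonoidAlgebra.of ℝ W (gen i)

theorem gA_mul_self (i : Fin 2) : gA i * gA i = 1 := by
  rw [gA, ← map_mul, gen_mul_self, map_one]

/-- Every group element is reached from `1` by multiplying by generators on the right. -/
theorem W_induction {p : W → Prop} (one : p 1) (mul : ∀ w i, p w → p (w * gen i))
    (w : W) : p w := by
  induction h : length w using Nat.strong_induction_on generalizing w with
  | _ n ih =>
    by_cases h0 : ∃ i, length (w * gen i) < length w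
    · obtain ⟨i, hi⟩ := h0
      have := mul _ i (ih _ (h ▸ hi) (w * gen i) rfl)
      rwa [mul_assoc, gen_mul_self, mul_one] at this
    · -- no generator shortens `w`, so `w = 1`
      push Not at h0
      have e0 := h0 0
      have e1 := h0 1
      rcases w with k | k
      · change ℤ at k
        have h1 : length (DihedralGroup.r k : W) = k.natAbs + k.natAbs := rfl
        have h2 : ∀ i, length (DihedralGroup.r k * gen i : W)
          = (((i : ℕ) : ℤ) - k - 1 + (0:ℕ)).natAbs + (((i : ℕ) : ℤ) - k - 1 + (1:ℕ)).natAbs :=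
          fun j => rfl
        rw [h1, h2] at e0 e1
        have : k = 0 := by simp at e0 e1; omega
        subst this
        exact one
      · change ℤ at k
        have h1 : length (DihedralGroup.sr k : W)
          = (k - 1 + (0:ℕ)).natAbs + (k - 1 + (1:ℕ)).natAbs := rfl
        have h2 : ∀ i, length (DihedralGroup.sr k * gen i : W)
          = (((i : ℕ) : ℤ) - k).natAbs + (((i : ℕ) : ℤ) - k).natAbs := fun j => rfl
        rw [h1, h2] at e0 e1
        simp at e0 e1; omega

/-- Induction over the group algebra as the algebra generated by `s` and `t`. -/
theorem groupAlgebra_induction {p : MonoidAlgebra ℝ W → Prop} (one : p 1)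
    (add : ∀ x y, p x → p y → p (x + y)) (smul : ∀ (c : ℝ) x, p x → p (c • x))
    (mul : ∀ x i, p x → p (x * gA i)) (y : MonoidAlgebra ℝ W) : p y := by
  induction y using MonoidAlgebra.induction_on with
  | of w =>
    induction w using W_induction with
    | one => rw [map_one]; exact one
    | mul w i ih => rw [map_mul]; exact mul _ i ih
  | add x y hx hy => exact add x y hx hy
  | smul c x hx => exact smul c x hx

/-- The element `st + ts` of the group algebra, a generator of its centre. -/
def zA : MonoidAlgebra ℝ W := gA 0 * gA 1 + gA 1 * gA 0

theorem gA_zero_mul_zA : gA 0 * zA = zA * gA 0 := by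
  have h := gA_mul_self 0
  simp only [zA, mul_add, add_mul]
  rw [← mul_assoc, h, mul_assoc (gA 1), h, one_mul, mul_one, mul_assoc, add_comm]

theorem gA_one_mul_zA : gA 1 * zA = zA * gA 1 := by
  have h := gA_mul_self 1
  simp only [zA, mul_add, add_mul]
  rw [← mul_assoc (gA 1) (gA 1), h, mul_assoc (gA 0), h, one_mul, mul_one, mul_assoc, add_comm]

theorem gA_one_mul_gA_zero : gA 1 * gA 0 = zA - gA 0 * gA 1 := by simp [zA]

theorem commute_zA (y : MonoidAlgebra ℝ W) : Commute zA y := by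
  induction y using groupAlgebra_induction with
  | one => exact Commute.one_right _
  | add x y hx hy => exact hx.add_right hy
  | smul c x hx => exact hx.smul_right c
  | mul x i hx =>
    refine hx.mul_right ?_
    fin_cases i
    · exact gA_zero_mul_zA.symm
    · exact gA_one_mul_zA.symm

theorem commute_aeval_zA (f : ℝ[X]) (y : MonoidAlgebra ℝ W) : Commute (aeval zA f) y := by
  induction f using Polynomial.induction_on' with
  | add f g hf hg => rw [map_add]; exact hf.add_left hg
  | monomial n a =>
    rw [aeval_monomial]
    exact (Algebra.commute_algebraMap_left a y).mul_left ((commute_zA y).pow_left n)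

/-- The group algebra as an algebra over the polynomial ring, the variable acting
as `st + ts`. -/
instance algebraPoly : Algebra ℝ[X] (MonoidAlgebra ℝ W) :=
  RingHom.toAlgebra' (aeval (R := ℝ) zA).toRingHom fun f y => (commute_aeval_zA f y).eq

theorem poly_smul (f : ℝ[X]) (y : MonoidAlgebra ℝ W) : f • y = aeval zA f * y := rfl

theorem algebraMap_poly (f : ℝ[X]) :
    algebraMap ℝ[X] (MonoidAlgebra ℝ W) f = aeval zA f := rfl

theorem X_smul_poly (y : MonoidAlgebra ℝ W) : (X : ℝ[X]) • y = zA * y := by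
  rw [poly_smul, aeval_X]

theorem normal_form_mul_s {A B : Type*} [CommRing A] [Ring B] [Algebra A B] {s t : B} {z : A}
    (hs : s * s = 1) (hts : t * s = z • (1 : B) - s * t) (a b c d : A) :
    (a • (1 : B) + b • s + c • t + d • (s * t)) * s
      = (b + c * z) • (1 : B) + (a + d * z) • s + (-d) • t + (-c) • (s * t) := by
  have h : s * t * s = z • s - t := by
    rw [mul_assoc, hts, mul_sub, mul_smul_comm, mul_one, ← mul_assoc, hs, one_mul]
  simp only [add_mul, smul_mul_assoc, one_mul, hs, hts, h]
  module

theorem normal_form_mul_t {A B : Type*} [CommRing A] [Ring B] [Algebra A B] {s t : B}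
    (ht : t * t = 1) (a b c d : A) :
    (a • (1 : B) + b • s + c • t + d • (s * t)) * t
      = c • (1 : B) + d • s + a • t + b • (s * t) := by
  simp only [add_mul, smul_mul_assoc, one_mul, mul_assoc, ht, mul_one]
  module

/-- `1, s, t, st` generate the group algebra over the polynomials in `st + ts`. -/
theorem exists_normal_form (y : MonoidAlgebra ℝ W) : ∃ a b c d : ℝ[X],
    y = a • (1 : MonoidAlgebra ℝ W) + b • gA 0 + c • gA 1 + d • (gA 0 * gA 1) := by
  induction y using groupAlgebra_induction with
  | one => exact ⟨1, 0, 0, 0, by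
    rw [one_smul, zero_smul, zero_smul, zero_smul]; simp only [add_zero]⟩
  | add x y hx hy =>
    obtain ⟨a, b, c, d, rfl⟩ := hx
    obtain ⟨a', b', c', d', rfl⟩ := hy
    exact ⟨a + a', b + b', c + c', d + d', by module⟩
  | smul r x hx =>
    obtain ⟨a, b, c, d, rfl⟩ := hx
    refine ⟨C r * a, C r * b, C r * c, C r * d, ?_⟩
    simp only [poly_smul, map_mul, aeval_C, smul_add, ← Algebra.smul_def, smul_mul_assoc]
  | mul x i hx =>
    obtain ⟨a, b, c, d, rfl⟩ := hx
    fin_cases i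
    · refine ⟨b + c * X, a + d * X, -d, -c, ?_⟩
      refine normal_form_mul_s (gA_mul_self 0) ?_ a b c d
      rw [X_smul_poly, mul_one, gA_one_mul_gA_zero]
    · exact ⟨c, d, a, b, normal_form_mul_t (gA_mul_self 1) a b c d⟩

/-- The image of `s` in the two-dimensional representation `theta`. -/
def matS : Matrix (Fin 2) (Fin 2) ℝ[X] := !![1, 0; 0, -1]

/-- The image of `t` in the two-dimensional representation `theta`. -/
def matT : Matrix (Fin 2) (Fin 2) ℝ[X] :=
  !![C (1 / 2) * X, 1; 1 - C (1 / 4) * X ^ 2, -(C (1 / 2) * X)]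

theorem C_half_sq : (C (1 / 2 : ℝ) * C (1 / 2) : ℝ[X]) = C (1 / 4) := by
  rw [← C_mul]; norm_num

theorem two_mul_C_half : (2 * C (1 / 2 : ℝ) : ℝ[X]) = 1 := by
  rw [← C_ofNat, ← C_mul]; norm_num

theorem matS_mul_self : matS * matS = 1 := by
  ext i j; fin_cases i <;> fin_cases j <;> simp [matS]

theorem matT_mul_self : matT * matT = 1 := by
  have h := C_half_sq
  rw [matT, Matrix.mul_fin_two]
  refine Matrix.ext fun i j => ?_
  fin_cases i <;> fin_cases j <;> simp [-one_div]
  · linear_combination X ^ 2 * h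
  · ring
  · linear_combination X ^ 2 * h

/-- The representation `theta` as a homomorphism of algebras over the scalars. -/
def thetaReal : MonoidAlgebra ℝ W →ₐ[ℝ] Matrix (Fin 2) (Fin 2) ℝ[X] :=
  MonoidAlgebra.lift ℝ _ W (dihedralLift matS matT matS_mul_self matT_mul_self)

theorem thetaReal_gA_zero : thetaReal (gA 0) = matS := by
  rw [thetaReal, gA, MonoidAlgebra.lift_of, dihedralLift_gen_zero]

theorem thetaReal_gA_one : thetaReal (gA 1) = matT := by
  rw [thetaReal, gA, MonoidAlgebra.lift_of, dihedralLift_gen_one]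

theorem thetaReal_zA : thetaReal zA = (X : ℝ[X]) • 1 := by
  have h := two_mul_C_half
  rw [zA, map_add, map_mul, map_mul, thetaReal_gA_zero, thetaReal_gA_one, matS, matT,
    Matrix.mul_fin_two, Matrix.mul_fin_two]
  refine Matrix.ext fun i j => ?_
  fin_cases i <;> fin_cases j <;> simp [-one_div]
  · linear_combination X * h
  · linear_combination X * h

theorem thetaReal_aeval_zA (f : ℝ[X]) : thetaReal (aeval zA f) = f • 1 := by
  induction f using Polynomial.induction_on' with
  | add f g hf hg => rw [map_add, map_add, hf, hg, add_smul]
  | monomial n a =>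
    rw [aeval_monomial, map_mul, AlgHom.commutes, map_pow, thetaReal_zA, _root_.smul_pow, one_pow,
      ← C_mul_X_pow_eq_monomial, mul_smul, Algebra.algebraMap_eq_smul_one, smul_mul_assoc, one_mul]
    refine Matrix.ext fun i j => ?_
    simp [Matrix.smul_apply, smul_eq_C_mul]

/-- The two-dimensional representation of the group algebra over its centre: an embedding into
the `2 × 2` matrices which realizes the reduced trace as the matrix trace. -/
def theta : MonoidAlgebra ℝ W →ₐ[ℝ[X]] Matrix (Fin 2) (Fin 2) ℝ[X] :=
  { thetaReal with
    commutes' := fun f => by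
      change thetaReal (aeval zA f) = _
      rw [thetaReal_aeval_zA, Algebra.algebraMap_eq_smul_one] }

theorem theta_gA_zero : theta (gA 0) = matS := thetaReal_gA_zero

theorem theta_gA_one : theta (gA 1) = matT := thetaReal_gA_one

theorem theta_normal_form (a b c d : ℝ[X]) :
    theta (a • (1 : MonoidAlgebra ℝ W) + b • gA 0 + c • gA 1 + d • (gA 0 * gA 1)) =
      !![a + b + C (1 / 2) * X * (c + d), c + d;
        (1 - C (1 / 4) * X ^ 2) * (c - d), a - b - C (1 / 2) * X * (c - d)] := by
  simp only [map_add, map_smul, map_mul, map_one, theta_gA_zero, theta_gA_one, matS, matT,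
    Matrix.mul_fin_two]
  refine Matrix.ext fun i j => ?_
  fin_cases i <;> fin_cases j <;> simp <;> ring

theorem trace_theta_normal_form (a b c d : ℝ[X]) :
    (theta (a • (1 : MonoidAlgebra ℝ W) + b • gA 0 + c • gA 1 + d • (gA 0 * gA 1))).trace
      = 2 * a + X * d := by
  rw [theta_normal_form, Matrix.trace_fin_two_of]
  linear_combination X * d * two_mul_C_half

/-- The images of `1, s, t, st` are linearly independent over the polynomials. -/
theorem theta_injective : Function.Injective theta := by
  rw [injective_iff_map_eq_zero]
  intro y hy
  obtain ⟨a, b, c, d, rfl⟩ := exists_normal_form y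
  rw [theta_normal_form] at hy
  have h00 := congrFun₂ hy 0 0
  have h01 := congrFun₂ hy 0 1
  have h10 := congrFun₂ hy 1 0
  have h11 := congrFun₂ hy 1 1
  simp only [Matrix.of_apply, Matrix.cons_val_zero, Matrix.cons_val_one, Matrix.zero_apply,
    Matrix.cons_val', Matrix.cons_val_fin_one] at h00 h01 h10 h11
  have hne : (1 - C (1 / 4) * X ^ 2 : ℝ[X]) ≠ 0 := fun h => by
    have := congrArg (Polynomial.eval 0) h
    simp at this
  have hcd : c - d = 0 := (mul_eq_zero.1 h10).resolve_left hne
  have two : (2 : ℝ[X]) ≠ 0 := two_ne_zero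
  have hc : c = 0 := mul_left_cancel₀ two (by linear_combination h01 + hcd)
  have hd : d = 0 := by linear_combination hc - hcd
  subst hc hd
  have ha : a = 0 := mul_left_cancel₀ two (by linear_combination h00 + h11)
  have hb : b = 0 := by subst ha; linear_combination h00
  subst ha hb
  simp

/-! ### Reduced traces of polynomials in a matrix -/

/-- The trace of an idempotent matrix over a field is a natural number. -/
theorem exists_trace_eq_natCast_of_isIdempotentElem {F n : Type*} [Field F] [Fintype n]
    [DecidableEq n] {E : Matrix n n F} (hE : IsIdempotentElem E) : ∃ c : ℕ, E.trace = c := by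
  have h : IsIdempotentElem (Matrix.toLin' E) := by
    rw [IsIdempotentElem, Module.End.mul_eq_comp, ← Matrix.toLin'_mul, hE.eq]
  exact ⟨Module.finrank F (Matrix.toLin' E).range, by
    rw [← (LinearMap.IsIdempotentElem.isProj_range _ h).trace, Matrix.trace_toLin'_eq]⟩

/-- If `X ^ k * g` kills a matrix over a field and `g 0 ≠ 0`, then `g` of the matrix is `g 0` times
the projection onto its generalized kernel, up to a nilpotent matrix; hence its trace is an
integral multiple of `g 0`. -/
theorem exists_trace_aeval_eq_of_field {F n : Type*} [Field F] [Fintype n] [DecidableEq n]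
    {A : Matrix n n F} {g : F[X]} {k : ℕ} (h0 : g.coeff 0 ≠ 0) (hA : aeval A (X ^ k * g) = 0) :
    ∃ c : ℕ, (aeval A g).trace = c * g.coeff 0 := by
  have hcop : IsCoprime (X ^ k) g := by
    refine IsCoprime.pow_left ((irreducible_X.coprime_iff_not_dvd).2 fun h => h0 ?_)
    exact X_dvd_iff.1 h
  obtain ⟨u, v, huv⟩ := hcop
  -- the projection onto the generalized kernel
  have hE : IsIdempotentElem (aeval A (v * g)) := by
    rw [IsIdempotentElem, ← map_mul, ← sub_eq_zero, ← map_sub]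
    have : v * g * (v * g) - v * g = X ^ k * g * (-(u * v)) := by linear_combination v * g * huv
    rw [this, map_mul, hA, zero_mul]
  obtain ⟨c, hc⟩ := exists_trace_eq_natCast_of_isIdempotentElem hE
  refine ⟨c, ?_⟩
  have hnil : IsNilpotent (aeval A (g - C (g.coeff 0) * (v * g))) := by
    rcases Nat.eq_zero_or_pos k with rfl | hk
    · rw [pow_zero, one_mul] at hA
      have : g - C (g.coeff 0) * (v * g) = g * (1 - C (g.coeff 0) * v) := by ring
      rw [this, map_mul, hA, zero_mul]
      exact IsNilpotent.zero
    · have hX : X ∣ 1 - C (g.coeff 0) * v := by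
        rw [X_dvd_iff]
        have := congrArg (fun p => p.coeff 0) huv
        simp only [coeff_add, mul_coeff_zero, coeff_X_pow, hk.ne, if_false, mul_zero, zero_add,
          coeff_one_zero] at this
        simp only [coeff_sub, mul_coeff_zero, coeff_C_zero, coeff_one_zero]
        linear_combination -this
      obtain ⟨w, hw⟩ := hX
      refine ⟨k, ?_⟩
      obtain ⟨j, rfl⟩ : ∃ j, k = j + 1 := ⟨k - 1, by omega⟩
      have : (g - C (g.coeff 0) * (v * g)) ^ (j + 1) = X ^ (j + 1) * g * (g ^ j * w ^ (j + 1)) := by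
        have h1 : g - C (g.coeff 0) * (v * g) = g * (X * w) := by rw [← hw]; ring
        rw [h1]; ring
      rw [← map_pow, this, map_mul, hA, zero_mul]
  have htr := (Matrix.isNilpotent_trace_of_isNilpotent hnil).eq_zero
  rw [map_sub, Matrix.trace_sub, sub_eq_zero, map_mul, aeval_C, ← Algebra.smul_def,
    Matrix.trace_smul, hc, smul_eq_mul, mul_comm] at htr
  exact htr

/-- The version of `exists_trace_aeval_eq_of_field` over an integral domain. -/
theorem exists_trace_aeval_eq {D n : Type*} [CommRing D] [IsDomain D] [Fintype n] [DecidableEq n]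
    {A : Matrix n n D} {g : D[X]} {k : ℕ} (h0 : g.coeff 0 ≠ 0) (hA : aeval A (X ^ k * g) = 0) :
    ∃ c : ℕ, (aeval A g).trace = c * g.coeff 0 := by
  let F := FractionRing D
  let φ : Matrix n n D →ₐ[D] Matrix n n F := (Algebra.ofId D F).mapMatrix
  have hinj : Function.Injective (algebraMap D F) := IsFractionRing.injective D F
  have key : ∀ f : D[X], aeval (φ A) (f.map (algebraMap D F)) = φ (aeval A f) := fun f => by
    rw [aeval_map_algebraMap, aeval_algHom_apply]
  have h0' : (g.map (algebraMap D F)).coeff 0 ≠ 0 := by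
    rw [coeff_map]
    exact fun h => h0 (hinj (h.trans (map_zero _).symm))
  obtain ⟨c, hc⟩ := exists_trace_aeval_eq_of_field (A := φ A) (k := k) h0' (by
    have := key (X ^ k * g)
    rw [hA, map_zero] at this
    simpa using this)
  refine ⟨c, hinj ?_⟩
  rw [key, coeff_map] at hc
  rw [map_mul, map_natCast, ← hc, AddMonoidHom.map_trace]
  rfl

variable {m : ℕ}

/-- The representation `theta` on matrices over the group algebra, with the blocks merged. -/
def thetaMat : Matrix (Fin m) (Fin m) (MonoidAlgebra ℝ W) →ₐ[ℝ[X]]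
    Matrix (Fin m × Fin 2) (Fin m × Fin 2) ℝ[X] :=
  (Matrix.compAlgEquiv (Fin m) (Fin 2) ℝ[X] ℝ[X]).toAlgHom.comp theta.mapMatrix

theorem thetaMat_injective : Function.Injective (thetaMat (m := m)) := by
  intro A B h
  refine Matrix.ext fun i j => theta_injective (Matrix.ext fun a b => ?_)
  exact congrFun₂ h (i, a) (j, b)

theorem trace_thetaMat (N : Matrix (Fin m) (Fin m) (MonoidAlgebra ℝ W)) :
    (thetaMat N).trace = (theta N.trace).trace := by
  have h : N.trace = ∑ i, N i i := rfl
  rw [h, map_sum, Matrix.trace_sum, Matrix.trace, Fintype.sum_prod_type]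
  rfl

/-- A matrix `B` over the group algebra is killed by a polynomial `X ^ k * g` over the polynomials
in `st + ts`, with `g 0 ≠ 0`, such that the reduced trace of `g B` is an integral multiple of
`g 0`: for `X ^ k * g` one takes the reduced characteristic polynomial. -/
theorem exists_polynomial_of_matrix (B : Matrix (Fin m) (Fin m) (MonoidAlgebra ℝ W)) :
    ∃ (g : ℝ[X][X]) (k c : ℕ), g.coeff 0 ≠ 0 ∧ B ^ k * aeval B g = 0 ∧
      (theta (aeval B g).trace).trace = c * g.coeff 0 := by
  have hne : (thetaMat B).charpoly ≠ 0 := (Matrix.charpoly_monic _).ne_zero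
  obtain ⟨g, hg, hdvd⟩ := Polynomial.exists_eq_pow_rootMultiplicity_mul_and_not_dvd _ hne 0
  rw [C_0, sub_zero] at hg hdvd
  have h0 : g.coeff 0 ≠ 0 := fun h => hdvd (X_dvd_iff.2 h)
  have hCH := Matrix.aeval_self_charpoly (thetaMat B)
  rw [hg] at hCH
  obtain ⟨c, hc⟩ := exists_trace_aeval_eq h0 hCH
  refine ⟨g, rootMultiplicity 0 (thetaMat B).charpoly, c, h0, thetaMat_injective ?_, ?_⟩
  · rw [aeval_algHom_apply, map_mul, map_pow, aeval_X] at hCH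
    rw [hCH, map_zero]
  · rw [← trace_thetaMat, ← hc, aeval_algHom_apply]

/-! ### The operators of right multiplication -/

theorem mul_gen_mul_gen (w : W) (i : Fin 2) : w * gen i * gen i = w := by
  rw [mul_assoc, gen_mul_self, mul_one]

theorem shift_apply (g : W) (f : L2) (w : W) : shift g f w = f (w * g) := rfl

open scoped Classical in
theorem restrict_apply (D : Set W) (f : L2) (w : W) :
    restrict D f w = if w ∈ D then f w else 0 := rfl

theorem inner_shift_gen (i : Fin 2) (x y : L2) :
    inner ℝ (shift (gen i) x) y = inner ℝ x (shift (gen i) y) := by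
  rw [lp.inner_eq_tsum, lp.inner_eq_tsum, ← (Equiv.mulRight (gen i)).tsum_eq]
  refine tsum_congr fun w => ?_
  simp only [Equiv.coe_mulRight, shift_apply, mul_gen_mul_gen]

theorem inner_restrict (D : Set W) (x y : L2) :
    inner ℝ (restrict D x) y = inner ℝ x (restrict D y) := by
  rw [lp.inner_eq_tsum, lp.inner_eq_tsum]
  refine tsum_congr fun w => ?_
  rw [restrict_apply, restrict_apply]
  split_ifs <;> simp

theorem inner_genRight (q : Param) (i : Fin 2) (x y : L2) :
    inner ℝ (genRight q i x) y = inner ℝ x (genRight q i y) := by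
  have h : ∀ z, genRight q i z = ((1 - (q i : ℝ)) / (1 + q i)) • z
      + (2 / (1 + (q i : ℝ))) • (Real.sqrt (q i) • shift (gen i) z
        + ((q i : ℝ) - 1) • restrict (descents i) z) := fun z => rfl
  simp only [h, inner_add_left, inner_add_right, real_inner_smul_left, real_inner_smul_right,
    inner_shift_gen, inner_restrict]

theorem genRight_genRight (q : Param) (i : Fin 2) (x : L2) :
    genRight q i (genRight q i x) = x :=
  congrArg (fun A : L2 →L[ℝ] L2 => A x) (genRight_mul_self q i)

theorem inner_genRight_genRight (q : Param) (i : Fin 2) (x y : L2) :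
    inner ℝ (genRight q i x) (genRight q i y) = inner ℝ x y := by
  rw [inner_genRight, genRight_genRight]

theorem norm_genRight (q : Param) (i : Fin 2) (x : L2) : ‖genRight q i x‖ = ‖x‖ := by
  rw [@norm_eq_sqrt_real_inner _ _ _ (genRight q i x), inner_genRight_genRight,
    ← norm_eq_sqrt_real_inner]

theorem R_one (q : Param) : R q 1 = 1 := by rw [R, map_one, MulOpposite.unop_one]

theorem R_mul (q : Param) (y y' : MonoidAlgebra ℝ W) : R q (y * y') = R q y' * R q y := by
  rw [R, map_mul, MulOpposite.unop_mul]; rfl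

theorem R_mul_apply (q : Param) (y y' : MonoidAlgebra ℝ W) (x : L2) :
    R q (y * y') x = R q y' (R q y x) := by rw [R_mul]; rfl

theorem R_add (q : Param) (y y' : MonoidAlgebra ℝ W) : R q (y + y') = R q y + R q y' := by
  rw [R, map_add]; rfl

theorem R_sub (q : Param) (y y' : MonoidAlgebra ℝ W) : R q (y - y') = R q y - R q y' := by
  rw [R, map_sub]; rfl

theorem R_smul (q : Param) (c : ℝ) (y : MonoidAlgebra ℝ W) : R q (c • y) = c • R q y := by
  rw [R, map_smul]; rfl

theorem R_zero (q : Param) : R q 0 = 0 := by rw [R, map_zero]; rfl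

theorem R_sum (q : Param) {ι : Type*} (s : Finset ι) (y : ι → MonoidAlgebra ℝ W) :
    R q (∑ i ∈ s, y i) = ∑ i ∈ s, R q (y i) := by
  rw [R, map_sum, Finset.unop_sum]; rfl

theorem R_gA (q : Param) (i : Fin 2) : R q (gA i) = genRight q i := R_gen q i

/-- Adjoints of right multiplications are right multiplications, by an element of the
group algebra that does not depend on the parameter. -/
theorem exists_adjoint (y : MonoidAlgebra ℝ W) : ∃ y' : MonoidAlgebra ℝ W,
    ∀ (q : Param) (x v : L2), inner ℝ (R q y x) v = inner ℝ x (R q y' v) := by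
  induction y using groupAlgebra_induction with
  | one => exact ⟨1, fun q x v => by rw [R_one]; rfl⟩
  | add y z hy hz =>
    obtain ⟨y', hy⟩ := hy
    obtain ⟨z', hz⟩ := hz
    refine ⟨y' + z', fun q x v => ?_⟩
    rw [R_add, R_add, add_apply, add_apply,
      inner_add_left, inner_add_right, hy, hz]
  | smul c y hy =>
    obtain ⟨y', hy⟩ := hy
    refine ⟨c • y', fun q x v => ?_⟩
    rw [R_smul, R_smul, smul_apply, smul_apply,
      real_inner_smul_left, real_inner_smul_right, hy]
  | mul y i hy =>
    obtain ⟨y', hy⟩ := hy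
    refine ⟨gA i * y', fun q x v => ?_⟩
    rw [R_mul_apply, R_mul_apply, R_gA, inner_genRight, hy]

/-- The operator of right multiplication by `st + ts`. -/
abbrev Z (q : Param) : L2 →L[ℝ] L2 := R q zA

theorem Z_apply (q : Param) (x : L2) :
    Z q x = genRight q 1 (genRight q 0 x) + genRight q 0 (genRight q 1 x) := by
  rw [Z, zA, R_add, R_mul, R_mul, R_gA, R_gA]; rfl

/-- The operator of right multiplication by `f (st + ts)`. -/
abbrev fZ (q : Param) (f : ℝ[X]) : L2 →L[ℝ] L2 := R q (aeval zA f)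

theorem commute_R_fZ (q : Param) (f : ℝ[X]) (y : MonoidAlgebra ℝ W) (x : L2) :
    R q y (fZ q f x) = fZ q f (R q y x) := by
  rw [fZ, ← R_mul_apply, ← R_mul_apply, (commute_aeval_zA f y).eq]

theorem fZ_mul (q : Param) (f g : ℝ[X]) (x : L2) : fZ q (f * g) x = fZ q f (fZ q g x) := by
  rw [fZ, map_mul, R_mul_apply, commute_R_fZ]

theorem inner_Z (q : Param) (x y : L2) : inner ℝ (Z q x) y = inner ℝ x (Z q y) := by
  rw [Z_apply, Z_apply, inner_add_left, inner_add_right, inner_genRight, inner_genRight,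
    inner_genRight, inner_genRight, add_comm]

theorem inner_fZ (q : Param) (f : ℝ[X]) (x y : L2) :
    inner ℝ (fZ q f x) y = inner ℝ x (fZ q f y) := by
  induction f using Polynomial.induction_on generalizing x y with
  | C a =>
    rw [fZ, aeval_C, Algebra.algebraMap_eq_smul_one, R_smul, R_one]
    exact (real_inner_smul_left _ _ _).trans (real_inner_smul_right _ _ _).symm
  | add f g hf hg =>
    rw [fZ, map_add, R_add, add_apply, add_apply,
      inner_add_left, inner_add_right, hf, hg]
  | monomial n a h =>
    have e : ∀ x, fZ q (C a * X ^ (n + 1)) x = Z q (fZ q (C a * X ^ n) x) := fun x => by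
      rw [pow_succ, ← mul_assoc, mul_comm _ X, fZ_mul, fZ, aeval_X]
    have e' : ∀ x, fZ q (C a * X ^ (n + 1)) x = fZ q (C a * X ^ n) (Z q x) := fun x => by
      rw [pow_succ, ← mul_assoc, fZ_mul, fZ, fZ, aeval_X]
    rw [e, e', inner_Z, h]

/-! ### Left multiplication -/

theorem memlp_comp_inv (f : L2) : Memℓp (fun w : W => f w⁻¹) 2 := by
  have h := (memℓp_gen_iff (p := 2) (by norm_num)).1 (lp.memℓp f)
  exact (memℓp_gen_iff (p := 2) (by norm_num)).2 ((Equiv.inv W).summable_iff.2 h)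

/-- The involution of `L²_q W` that sends `T_w` to `T_v`, where `v` is the inverse of `w`; it
exchanges left and right multiplication. -/
def flip : L2 →ₗ[ℝ] L2 where
  toFun f := ⟨fun w => f w⁻¹, memlp_comp_inv f⟩
  map_add' _ _ := rfl
  map_smul' _ _ := rfl

theorem flip_apply (f : L2) (w : W) : flip f w = f w⁻¹ := rfl

theorem inner_flip (x y : L2) : inner ℝ (flip x) (flip y) = inner ℝ x y := by
  rw [lp.inner_eq_tsum, lp.inner_eq_tsum, ← (Equiv.inv W).tsum_eq]
  refine tsum_congr fun w => ?_
  simp only [Equiv.inv_apply, flip_apply, inv_inv]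

theorem flip_flip (x : L2) : flip (flip x) = x := by
  ext w; rw [flip_apply, flip_apply, inv_inv]

theorem genRight_apply (q : Param) (i : Fin 2) (f : L2) (w : W) :
    genRight q i f w = (1 - (q i : ℝ)) / (1 + q i) * f w
      + 2 / (1 + (q i : ℝ)) * (Real.sqrt (q i) * f (w * gen i)
      + ((q i : ℝ) - 1) * (open scoped Classical in if w ∈ descents i then f w else 0)) := rfl

/-- Left multiplication by the image of the generator `gen i` in the Hecke algebra. -/
def genLeft (q : Param) (i : Fin 2) : L2 →ₗ[ℝ] L2 := flip ∘ₗ (genRight q i : L2 →ₗ[ℝ] L2) ∘ₗ flip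

theorem genLeft_eq (q : Param) (i : Fin 2) (f : L2) :
    genLeft q i f = flip (genRight q i (flip f)) := rfl

open scoped Classical in
theorem genLeft_apply (q : Param) (i : Fin 2) (f : L2) (w : W) :
    genLeft q i f w = (1 - (q i : ℝ)) / (1 + q i) * f w
      + 2 / (1 + (q i : ℝ)) * (Real.sqrt (q i) * f (gen i * w)
      + ((q i : ℝ) - 1) * if w⁻¹ ∈ descents i then f w else 0) := by
  rw [genLeft_eq, flip_apply, genRight_apply, flip_apply, flip_apply, inv_inv, mul_inv_rev, inv_inv]
  rfl

theorem genLeft_genLeft (q : Param) (i : Fin 2) (x : L2) : genLeft q i (genLeft q i x) = x := by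
  rw [genLeft_eq, genLeft_eq, flip_flip, genRight_genRight, flip_flip]

theorem inner_genLeft_genLeft (q : Param) (i : Fin 2) (x y : L2) :
    inner ℝ (genLeft q i x) (genLeft q i y) = inner ℝ x y := by
  rw [genLeft_eq, genLeft_eq, inner_flip, inner_genRight_genRight, inner_flip]

theorem inner_genLeft (q : Param) (i : Fin 2) (x y : L2) :
    inner ℝ (genLeft q i x) y = inner ℝ x (genLeft q i y) := by
  rw [← inner_genLeft_genLeft, genLeft_genLeft]

theorem length_r (k : ℤ) : length (DihedralGroup.r k : W) = k.natAbs + k.natAbs := rfl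

theorem length_sr (k : ℤ) : length (DihedralGroup.sr k : W) = (k - 1).natAbs + k.natAbs := by
  have h : length (DihedralGroup.sr k : W) = (k - 1 + 0).natAbs + (k - 1 + 1).natAbs := rfl
  rwa [add_zero, sub_add_cancel] at h

theorem r_mul_gen (k : ℤ) (i : Fin 2) :
    (DihedralGroup.r k : W) * gen i = DihedralGroup.sr ((((i : ℕ) : ℤ) - k : ℤ) : ℤ) := rfl

theorem sr_mul_gen (k : ℤ) (i : Fin 2) :
    (DihedralGroup.sr k : W) * gen i = DihedralGroup.r ((((i : ℕ) : ℤ) - k : ℤ) : ℤ) := rfl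

theorem gen_mul_r (k : ℤ) (i : Fin 2) :
    gen i * (DihedralGroup.r k : W) = DihedralGroup.sr ((((i : ℕ) : ℤ) + k : ℤ) : ℤ) := rfl

theorem gen_mul_sr (k : ℤ) (i : Fin 2) :
    gen i * (DihedralGroup.sr k : W) = DihedralGroup.r ((k - ((i : ℕ) : ℤ) : ℤ) : ℤ) := rfl

theorem inv_r (k : ℤ) : (DihedralGroup.r k : W)⁻¹ = DihedralGroup.r ((-k : ℤ) : ℤ) := rfl

theorem inv_sr (k : ℤ) : (DihedralGroup.sr k : W)⁻¹ = DihedralGroup.sr k := rfl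

theorem mem_descents (i : Fin 2) (w : W) : w ∈ descents i ↔ length (w * gen i) < length w := Iff.rfl

/-- Multiplication by `gen i` on the left does not change whether `gen j` is a right descent, and
multiplication by `gen j` on the right does not change whether `gen i` is a left descent, unless
`gen i * w = w * gen j`, in which case `i = j` and both change. -/
theorem descents_cases (i j : Fin 2) (w : W) :
    ((gen i * w ∈ descents j ↔ w ∈ descents j) ∧
      ((w * gen j)⁻¹ ∈ descents i ↔ w⁻¹ ∈ descents i)) ∨
    (gen i * w = w * gen j ∧ i = j ∧ (w⁻¹ ∈ descents i ↔ w ∈ descents j) ∧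
      (gen i * w ∈ descents j ↔ w ∉ descents j) ∧
      ((w * gen j)⁻¹ ∈ descents i ↔ w ∉ descents j)) := by
  rcases w with k | k
  · change ℤ at k
    simp only [mem_descents, gen_mul_r, r_mul_gen, sr_mul_gen, inv_r, inv_sr, length_r, length_sr]
    by_cases h : i = j ∧ k = 0
    · obtain ⟨rfl, rfl⟩ := h
      right
      refine ⟨by simp, rfl, ?_, ?_, ?_⟩ <;> fin_cases i <;> simp
    · left
      fin_cases i <;> fin_cases j <;> simp at h ⊢ <;> omega
  · change ℤ at k
    simp only [mem_descents, gen_mul_sr, r_mul_gen, sr_mul_gen, inv_r, inv_sr, length_r, length_sr]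
    by_cases h : i = j ∧ k = ((i : ℕ) : ℤ)
    · obtain ⟨rfl, rfl⟩ := h
      right
      refine ⟨by simp, rfl, ?_, ?_, ?_⟩ <;> fin_cases i <;> simp
    · left
      fin_cases i <;> fin_cases j <;> simp at h ⊢ <;> omega

/-- Left and right multiplication by generators commute. -/
theorem genLeft_genRight (q : Param) (i j : Fin 2) (x : L2) :
    genLeft q i (genRight q j x) = genRight q j (genLeft q i x) := by
  ext w
  rw [genLeft_apply, genRight_apply, genRight_apply, genRight_apply, genLeft_apply, genLeft_apply,
    mul_assoc]
  rcases descents_cases i j w with ⟨h1, h2⟩ | ⟨h, rfl, h0, h1, h2⟩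
  · split_ifs <;> first | ring1 | (exfalso; tauto)
  · have e : gen i * (w * gen i) = w := by rw [← h, ← mul_assoc, gen_mul_self, one_mul]
    rw [e, h] at *
    split_ifs <;> first | ring1 | (exfalso; tauto)

theorem genLeft_R (q : Param) (i : Fin 2) (y : MonoidAlgebra ℝ W) (x : L2) :
    genLeft q i (R q y x) = R q y (genLeft q i x) := by
  induction y using groupAlgebra_induction generalizing x with
  | one => rw [R_one]; rfl
  | add y z hy hz => rw [R_add, add_apply, add_apply, map_add, hy, hz]
  | smul c y hy => rw [R_smul, smul_apply, smul_apply, map_smul, hy]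
  | mul y j hy => rw [R_mul_apply, R_mul_apply, R_gA, genLeft_genRight, hy]

theorem one_apply (q : Param) (w : W) : one q w = if w = 1 then 1 else 0 := by
  have h : qpow q 1 = 1 := by
    change (q 0 : ℝ) ^ 0 * (q 1 : ℝ) ^ 0 = 1
    simp
  rw [one, T, h, Real.sqrt_one, lp.single_apply, Pi.single_apply]

theorem flip_one (q : Param) : flip (one q) = one q := by
  ext w
  simp only [flip_apply, one_apply, inv_eq_one]

theorem genRight_one (q : Param) (i : Fin 2) : genRight q i (one q) =
    ((1 - (q i : ℝ)) / (1 + q i)) • one q + (2 / (1 + (q i : ℝ))) • T q (gen i) := by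
  have h1 : length 1 < length (1 * gen i) := by
    fin_cases i <;> decide
  have h := heckeRight_T q i 1
  rw [if_pos h1, one_mul] at h
  rw [← h]; rfl

theorem genLeft_one (q : Param) (i : Fin 2) : genLeft q i (one q) = genRight q i (one q) := by
  rw [genLeft_eq, flip_one]
  ext w
  have h : gen i ≠ 1 := by fin_cases i <;> decide
  have hi : (gen i)⁻¹ = gen i := rfl
  have hw : w⁻¹ = gen i ↔ w = gen i := by rw [inv_eq_iff_eq_inv, hi]
  have hT : ∀ v u : W, T q v u = if u = v then Real.sqrt (qpow q v) else 0 := fun v u => by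
    simp [T, lp.single_apply, Pi.single_apply]
  rw [flip_apply, genRight_one]
  change _ * one q w⁻¹ + _ * T q (gen i) w⁻¹ = _ * one q w + _ * T q (gen i) w
  rw [one_apply, one_apply, hT, hT]
  simp only [inv_eq_one, hw]

/-! ### Eigenvectors of `st + ts` -/

/-- For a recursion with reciprocal characteristic roots the quadratic form
`y ^ 2 - m * x * y + x ^ 2` is constant along solutions, so it vanishes on decaying ones. -/
theorem quadratic_eq_zero_of_tendsto_zero {c : ℕ → ℝ} {m : ℝ}
    (h : ∀ j, c (j + 2) = m * c (j + 1) - c j) (h0 : Tendsto c atTop (𝓝 0)) :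
    c 1 ^ 2 - m * c 0 * c 1 + c 0 ^ 2 = 0 := by
  have hconst : ∀ j, c (j + 1) ^ 2 - m * c j * c (j + 1) + c j ^ 2
      = c 1 ^ 2 - m * c 0 * c 1 + c 0 ^ 2 := fun j => by
    induction j with
    | zero => rfl
    | succ j ih => rw [← ih, h]; ring
  have h1 := h0.comp (tendsto_add_atTop_nat 1)
  have h2 : Tendsto (fun j => c (j + 1) ^ 2 - m * c j * c (j + 1) + c j ^ 2) atTop
      (𝓝 (0 ^ 2 - m * 0 * 0 + 0 ^ 2)) :=
    ((h1.pow 2).sub ((h0.const_mul m).mul h1)).add (h0.pow 2)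
  simp only [hconst] at h2
  have := tendsto_nhds_unique h2 tendsto_const_nhds
  simpa using this.symm

theorem abs_ratio_lt_one {c : ℕ → ℝ} {m : ℝ} (h : ∀ j, c (j + 2) = m * c (j + 1) - c j)
    (h0 : Tendsto c atTop (𝓝 0)) (hc : c 0 ≠ 0) : |c 1 / c 0| < 1 := by
  have hq := quadratic_eq_zero_of_tendsto_zero h h0
  set r := c 1 / c 0 with hr
  have h1 : c 1 = c 0 * r := by rw [hr]; field_simp
  have hrr : r ^ 2 - m * r + 1 = 0 := by
    have : c 0 ^ 2 * (r ^ 2 - m * r + 1) = 0 := by rw [h1] at hq; linear_combination hq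
    exact (mul_eq_zero.1 this).resolve_left (pow_ne_zero 2 hc)
  have hpow : ∀ j, c j = c 0 * r ^ j ∧ c (j + 1) = c 0 * r ^ (j + 1) := fun j => by
    induction j with
    | zero => exact ⟨by ring, by rw [zero_add, pow_one, h1]⟩
    | succ j ih =>
      refine ⟨ih.2, ?_⟩
      rw [h, ih.1, ih.2]
      linear_combination -c 0 * r ^ j * hrr
  have ht : Tendsto (fun j => r ^ j) atTop (𝓝 0) := by
    have := h0.const_mul (c 0)⁻¹
    rw [mul_zero] at this
    refine this.congr fun j => ?_
    rw [(hpow j).1, ← mul_assoc, inv_mul_cancel₀ hc, one_mul]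
  exact tendsto_pow_atTop_nhds_zero_iff.1 ht

theorem eq_zero_of_recursion {c : ℕ → ℝ} {m : ℝ} (h : ∀ j, c (j + 2) = m * c (j + 1) - c j)
    (h0 : Tendsto c atTop (𝓝 0)) (hc : c 0 = 0) (j : ℕ) : c j = 0 := by
  have hq := quadratic_eq_zero_of_tendsto_zero h h0
  have h1 : c 1 = 0 := by
    rw [hc] at hq
    exact pow_eq_zero_iff (two_ne_zero) |>.1 (by linear_combination hq)
  have : ∀ j, c j = 0 ∧ c (j + 1) = 0 := fun j => by
    induction j with
    | zero => exact ⟨hc, h1⟩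
    | succ j ih => exact ⟨ih.2, by rw [h, ih.1, ih.2]; ring⟩
  exact (this j).1

/-- Two decaying half-line solutions of the same recursion can only be glued to an eigenvector
of the line at two energies: both decay at the same rate, and the two gluing conditions then
determine that rate. -/
theorem energy_of_decaying_solution {c e : ℕ → ℝ} {ρ A C D : ℝ} (hρ : ρ ≠ 0) (hD : D ≠ 0)
    (hCD : C ^ 2 + D ^ 2 = 1)
    (hc : ∀ j, D * ρ * c j - C * c (j + 1) + ρ * (C * ρ * c (j + 1) + D * c (j + 2))
      = A * c (j + 1))
    (hc0 : C * c 0 + D * e 0 + ρ * (C * ρ * c 0 + D * c 1) = A * c 0)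
    (he : ∀ j, D * ρ * e j - C * e (j + 1) + ρ * (C * ρ * e (j + 1) + D * e (j + 2))
      = A * e (j + 1))
    (he0 : D * c 0 - C * e 0 + ρ * (C * ρ * e 0 + D * e 1) = A * e 0)
    (tc : Tendsto c atTop (𝓝 0)) (te : Tendsto e atTop (𝓝 0)) :
    (∀ j, c j = 0 ∧ e j = 0) ∨ A ^ 2 = (1 + ρ ^ 2) ^ 2 := by
  have hDρ : D * ρ ≠ 0 := mul_ne_zero hD hρ
  set m := (A + C - C * ρ ^ 2) / (D * ρ) with hm
  have hmA : D * ρ * m = A + C - C * ρ ^ 2 := by rw [hm]; field_simp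
  have hc' : ∀ j, c (j + 2) = m * c (j + 1) - c j := fun j =>
    mul_left_cancel₀ hDρ (by linear_combination hc j - c (j + 1) * hmA)
  have he' : ∀ j, e (j + 2) = m * e (j + 1) - e j := fun j =>
    mul_left_cancel₀ hDρ (by linear_combination he j - e (j + 1) * hmA)
  have qc := quadratic_eq_zero_of_tendsto_zero hc' tc
  have qe := quadratic_eq_zero_of_tendsto_zero he' te
  by_cases h1 : c 0 = 0
  · left
    have c1 := eq_zero_of_recursion hc' tc h1
    have : e 0 = 0 := by
      rw [h1, c1 1] at hc0
      exact mul_left_cancel₀ hD (by linear_combination hc0)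
    exact fun j => ⟨c1 j, eq_zero_of_recursion he' te this j⟩
  by_cases h2 : e 0 = 0
  · left
    have e1 := eq_zero_of_recursion he' te h2
    have : c 0 = 0 := by
      rw [h2, e1 1] at he0
      exact mul_left_cancel₀ hD (by linear_combination he0)
    exact absurd this h1
  right
  have rc := abs_ratio_lt_one hc' tc h1
  have re := abs_ratio_lt_one he' te h2
  set r := c 1 / c 0 with hr
  set r' := e 1 / e 0 with hr'
  have hc1 : c 1 = c 0 * r := by rw [hr]; field_simp
  have he1 : e 1 = e 0 * r' := by rw [hr']; field_simp
  have hrr : r ^ 2 - m * r + 1 = 0 := by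
    have : c 0 ^ 2 * (r ^ 2 - m * r + 1) = 0 := by rw [hc1] at qc; linear_combination qc
    exact (mul_eq_zero.1 this).resolve_left (pow_ne_zero 2 h1)
  have hrr' : r' ^ 2 - m * r' + 1 = 0 := by
    have : e 0 ^ 2 * (r' ^ 2 - m * r' + 1) = 0 := by rw [he1] at qe; linear_combination qe
    exact (mul_eq_zero.1 this).resolve_left (pow_ne_zero 2 h2)
  have heq : r' = r := by
    have : (r' - r) * (r' + r - m) = 0 := by linear_combination hrr' - hrr
    rcases mul_eq_zero.1 this with h | h
    · linarith
    · -- otherwise the two ratios are the two reciprocal characteristic roots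
      exfalso
      have hp : r * r' = 1 := by linear_combination r * h - hrr
      have : |r * r'| < 1 := by
        rw [abs_mul]; exact mul_lt_one_of_nonneg_of_lt_one_left (abs_nonneg _) rc re.le
      rw [hp, abs_one] at this
      exact lt_irrefl _ this
  rw [heq] at he1
  have hr0 : r ≠ 0 := fun h => by rw [h] at hrr; norm_num at hrr
  clear_value r r' m
  -- the gluing condition at the second vertex fixes the ratio of the two solutions
  have g1 : ρ * e 0 = r * c 0 := by
    have : D * (ρ * e 0 - r * c 0) = 0 := by
      rw [he1] at he0
      linear_combination r * (-he0) + D * ρ * e 0 * hrr + r * e 0 * hmA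
    linarith [(mul_eq_zero.1 this).resolve_left hD]
  have hAr : A * r = D * ρ * (r ^ 2 + 1) - C * r + C * ρ ^ 2 * r := by
    linear_combination -r * hmA - D * ρ * hrr
  -- the gluing condition at the first vertex then fixes the rate of decay
  have g2 : 2 * C * r * ρ + D * r ^ 2 = D * ρ ^ 2 := by
    rw [hc1] at hc0
    refine mul_left_cancel₀ h1 ?_
    linear_combination r * ρ * hc0 - D * r * g1 + ρ * c 0 * hAr
  have hA : A * r = (1 + ρ ^ 2) * (D * ρ - C * r) := by linear_combination hAr + ρ * g2
  refine mul_right_cancel₀ (pow_ne_zero 2 hr0) ?_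
  linear_combination (A * r + (1 + ρ ^ 2) * (D * ρ - C * r)) * hA
    + (1 + ρ ^ 2) ^ 2 * (r ^ 2 * hCD - D * g2)

theorem tendsto_coordinates_zero (v : L2) {g : ℕ → W} (hg : Function.Injective g) :
    Tendsto (fun n => v (g n)) atTop (𝓝 0) := by
  have h := ((memℓp_gen_iff (p := 2) (by norm_num)).1 (lp.memℓp v)).tendsto_cofinite_zero
  have h1 := h.comp hg.tendsto_cofinite
  rw [Nat.cofinite_eq_atTop] at h1
  have h2 : Tendsto (fun n => Real.sqrt ((v (g n)) ^ 2)) atTop (𝓝 (Real.sqrt 0)) := by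
    refine (Real.continuous_sqrt.tendsto 0).comp (h1.congr fun n => ?_)
    simp
  simp only [Real.sqrt_sq_eq_abs, Real.sqrt_zero] at h2
  exact tendsto_zero_iff_abs_tendsto_zero _ |>.2 h2

/-- The generator `gen i` acts on the values at each pair `w, w * gen i`, `w` the shorter one, by
the reflection with matrix `(cosQ, sinQ; sinQ, -cosQ)`. -/
def cosQ (q : Param) (i : Fin 2) : ℝ := (1 - (q i : ℝ)) / (1 + q i)

/-- The off-diagonal entry of the reflection described at `cosQ`. -/
def sinQ (q : Param) (i : Fin 2) : ℝ := 2 * Real.sqrt (q i) / (1 + q i)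

theorem one_add_pos (q : Param) (i : Fin 2) : 0 < 1 + (q i : ℝ) := by
  have := (q i).2; positivity

theorem cosQ_sq_add_sinQ_sq (q : Param) (i : Fin 2) : cosQ q i ^ 2 + sinQ q i ^ 2 = 1 := by
  have h := (one_add_pos q i).ne'
  rw [cosQ, sinQ, div_pow, div_pow, mul_pow, Real.sq_sqrt (q i).2.le]
  field_simp
  ring

theorem sinQ_pos (q : Param) (i : Fin 2) : 0 < sinQ q i := by
  have h := one_add_pos q i
  have := Real.sqrt_pos.2 (q i).2
  rw [sinQ]; positivity

theorem genRight_of_not_mem {q : Param} {i : Fin 2} {w : W} (h : w ∉ descents i) (f : L2) :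
    genRight q i f w = cosQ q i * f w + sinQ q i * f (w * gen i) := by
  rw [genRight_apply, if_neg h, cosQ, sinQ]; ring

theorem genRight_of_mem {q : Param} {i : Fin 2} {w : W} (h : w ∈ descents i) (f : L2) :
    genRight q i f w = sinQ q i * f (w * gen i) - cosQ q i * f w := by
  have h0 := (one_add_pos q i).ne'
  rw [genRight_apply, if_pos h, cosQ, sinQ]
  field_simp
  ring

theorem apply_mul_gen_of_eigenvector {q : Param} {i : Fin 2} {ε : ℝ} {v : L2}
    (hv : genRight q i v = ε • v) {w : W} (h : w ∉ descents i) :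
    v (w * gen i) = (ε - cosQ q i) / sinQ q i * v w := by
  have h0 := (sinQ_pos q i).ne'
  have h1 : genRight q i v w = ε * v w := by rw [hv]; rfl
  rw [genRight_of_not_mem h] at h1
  field_simp
  linear_combination h1

/-- The elements `(st)^n`. -/
def stPow (n : ℕ) : W := DihedralGroup.r (((n : ℤ)) : ℤ)

/-- The elements `(ts)^n`. -/
def tsPow (n : ℕ) : W := DihedralGroup.r ((-(n : ℤ) : ℤ) : ℤ)

theorem stPow_injective : Function.Injective stPow := fun a b h => by
  have : (a : ℤ) = b := DihedralGroup.r.inj h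
  exact_mod_cast this

theorem tsPow_injective : Function.Injective tsPow := fun a b h => by
  have : -(a : ℤ) = -b := DihedralGroup.r.inj h
  omega

theorem tsPow_zero : tsPow 0 = stPow 0 := rfl

theorem stPow_gen_gen (n : ℕ) : stPow n * gen 0 * gen 1 = stPow (n + 1) := by
  exact congrArg DihedralGroup.r (by push_cast; ring : (1 : ℤ) - ((0 : ℤ) - n) = ((n + 1 : ℕ) : ℤ))

theorem tsPow_gen_gen (n : ℕ) : tsPow n * gen 1 * gen 0 = tsPow (n + 1) := by
  exact congrArg DihedralGroup.r
    (by push_cast; ring : (0 : ℤ) - ((1 : ℤ) - -(n : ℤ)) = -((n + 1 : ℕ) : ℤ))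

theorem stPow_not_mem (n : ℕ) : stPow n ∉ descents 0 := by
  rw [mem_descents, stPow, r_mul_gen, length_r, length_sr]; simp; omega

theorem stPow_gen_not_mem (n : ℕ) : stPow n * gen 0 ∉ descents 1 := by
  rw [mem_descents, stPow, r_mul_gen, sr_mul_gen, length_r, length_sr]; simp; omega

theorem tsPow_not_mem (n : ℕ) : tsPow n ∉ descents 1 := by
  rw [mem_descents, tsPow, r_mul_gen, length_r, length_sr]; simp; omega

theorem tsPow_gen_not_mem (n : ℕ) : tsPow n * gen 1 ∉ descents 0 := by
  rw [mem_descents, tsPow, r_mul_gen, sr_mul_gen, length_r, length_sr]; simp; omega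

theorem mul_gen_mem {w : W} {i : Fin 2} (h : w ∉ descents i) : w * gen i ∈ descents i := by
  rw [mem_descents, mul_gen_mul_gen]
  rw [mem_descents] at h
  rcases letters_mul_gen i w with h1 | h1
  · exact h1.1
  · exact absurd h1.1 h

/-- The elements of `W`, grouped by the pairs `w, ws`, with `w` the first and the third form
and `ws` the second and the fourth. -/
theorem W_cases (w : W) : ∃ n, w = stPow n ∨ w = stPow n * gen 0 ∨ w = tsPow n * gen 1 ∨
    w = tsPow (n + 1) := by
  rcases w with k | k
  · change ℤ at k
    rcases le_or_gt 0 k with h | h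
    · refine ⟨k.toNat, Or.inl ?_⟩
      rw [stPow, Int.toNat_of_nonneg h]
    · refine ⟨(-k - 1).toNat, Or.inr (Or.inr (Or.inr ?_))⟩
      rw [tsPow]; congr 1; change k = _; omega
  · change ℤ at k
    rcases le_or_gt k 0 with h | h
    · refine ⟨(-k).toNat, Or.inr (Or.inl ?_)⟩
      rw [stPow, r_mul_gen]; congr 1; change k = _; simp; omega
    · refine ⟨(k - 1).toNat, Or.inr (Or.inr (Or.inl ?_))⟩
      rw [tsPow, r_mul_gen]; congr 1; change k = _; simp; omega

/-- An eigenvector of `st + ts` that is also an eigenvector of `s` has eigenvalue `2` or `-2`. -/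
theorem eigenvalue_sq_of_gen_eigenvector {q : Param} {ε a : ℝ} (hε : ε ^ 2 = 1) {v : L2}
    (hs : genRight q 0 v = ε • v) (hz : Z q v = a • v) : v = 0 ∨ a ^ 2 = 4 := by
  have hCD0 := cosQ_sq_add_sinQ_sq q 0
  have hCD := cosQ_sq_add_sinQ_sq q 1
  have hD0 := (sinQ_pos q 0).ne'
  have hD := (sinQ_pos q 1).ne'
  set C0 := cosQ q 0 with hC0
  set D0 := sinQ q 0 with hD0'
  set C := cosQ q 1 with hC
  set D := sinQ q 1 with hD'
  -- the ratio of the values of `v` at `ws` and at `w`, for `w` shorter than `ws`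
  set ρ := (ε - C0) / D0 with hρ
  have hprod : (ε - C0) * (ε + C0) = D0 ^ 2 := by linear_combination hε - hCD0
  have hne : ε + C0 ≠ 0 := fun h => by
    rw [h, mul_zero] at hprod; exact pow_ne_zero 2 hD0 hprod.symm
  have hne' : ε - C0 ≠ 0 := fun h => by
    rw [h, zero_mul] at hprod; exact pow_ne_zero 2 hD0 hprod.symm
  have hρ0 : ρ ≠ 0 := div_ne_zero hne' hD0
  have hρD : ρ * D0 = ε - C0 := by rw [hρ]; field_simp
  have hρ' : (C0 + ε) * ρ = D0 :=
    mul_right_cancel₀ hD0 (by linear_combination (C0 + ε) * hρD + hprod)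
  -- the values of `v` and of `T v` along the Cayley graph
  have v0 : ∀ n, v (stPow n * gen 0) = ρ * v (stPow n) := fun n =>
    apply_mul_gen_of_eigenvector hs (stPow_not_mem n)
  have v1 : ∀ n, v (tsPow (n + 1)) = ρ * v (tsPow n * gen 1) := fun n => by
    rw [← tsPow_gen_gen]
    exact apply_mul_gen_of_eigenvector hs (tsPow_gen_not_mem n)
  set u := genRight q 1 v with hu
  have hsu : genRight q 0 u + ε • u = a • v := by
    rw [← hz, Z_apply, hs, map_smul, add_comm]
  -- the eigenvalue equation, read off at the shorter element of each pair `w, ws`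
  have hpair : ∀ w, w ∉ descents 0 → u w + ρ * u (w * gen 0) = a / (C0 + ε) * v w := fun w hw => by
    have h1 : genRight q 0 u w + ε * u w = a * v w := congrArg (fun f : L2 => f w) hsu
    rw [genRight_of_not_mem hw, ← hC0, ← hD0'] at h1
    have : C0 + ε ≠ 0 := by rwa [add_comm]
    field_simp
    linear_combination h1 + u (w * gen 0) * hρ'
  have u0 : ∀ n, u (stPow n * gen 0) = C * (ρ * v (stPow n)) + D * v (stPow (n + 1)) := fun n => by
    rw [hu, genRight_of_not_mem (stPow_gen_not_mem n), stPow_gen_gen, v0]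
  have u1 : ∀ n, u (stPow (n + 1)) = D * (ρ * v (stPow n)) - C * v (stPow (n + 1)) := fun n => by
    have := mul_gen_mem (stPow_gen_not_mem n)
    rw [stPow_gen_gen] at this
    rw [hu, genRight_of_mem this, ← v0, ← stPow_gen_gen, mul_gen_mul_gen]
  have u2 : ∀ n, u (tsPow n) = C * v (tsPow n) + D * v (tsPow n * gen 1) := fun n => by
    rw [hu, genRight_of_not_mem (tsPow_not_mem n)]
  have u3 : ∀ n, u (tsPow n * gen 1) = D * v (tsPow n) - C * v (tsPow n * gen 1) := fun n => by
    rw [hu, genRight_of_mem (mul_gen_mem (tsPow_not_mem n)), mul_gen_mul_gen]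
  have key := energy_of_decaying_solution (c := fun n => v (stPow n))
    (e := fun n => v (tsPow n * gen 1)) (A := a / (C0 + ε)) hρ0 hD hCD
    (fun j => by
      have := hpair _ (stPow_not_mem (j + 1))
      rw [u0, u1] at this
      linear_combination this)
    (by
      have := hpair _ (stPow_not_mem 0)
      rw [u0, ← tsPow_zero, u2] at this
      simp only [tsPow_zero, zero_add] at this ⊢
      linear_combination this)
    (fun j => by
      have := hpair _ (tsPow_gen_not_mem (j + 1))
      rw [tsPow_gen_gen, u2, u3, v1, v1] at this
      linear_combination this)
    (by
      have := hpair _ (tsPow_gen_not_mem 0)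
      rw [tsPow_gen_gen, u2, u3, v1, tsPow_zero] at this
      simp only [tsPow_zero, zero_add] at this ⊢
      linear_combination this)
    (tendsto_coordinates_zero v stPow_injective)
    (tendsto_coordinates_zero v fun a b h => tsPow_injective (mul_right_cancel h))
  rcases key with h | h
  · left
    ext w
    obtain ⟨n, rfl | rfl | rfl | rfl⟩ := W_cases w
    · exact (h n).1
    · rw [v0, (h n).1, mul_zero]; rfl
    · exact (h n).2
    · rw [v1, (h n).2, mul_zero]; rfl
  · right
    have hne2 : C0 + ε ≠ 0 := by rwa [add_comm]
    have hA : a = a / (C0 + ε) * (C0 + ε) := by field_simp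
    have h2 : (1 + ρ ^ 2) * (C0 + ε) = 2 * ε := by
      linear_combination ρ * hρ' + hρD
    rw [hA, mul_pow, h, ← mul_pow, h2]
    linear_combination 4 * hε

/-! ### Characters of `W` and the continuous part -/

/-- The closed subspace on which `gen i` acts by the sign `χ i`. -/
def charSpace (q : Param) (χ : Fin 2 → ℤˣ) : Submodule ℝ L2 :=
  ⨅ i, (genRight q i - ((χ i : ℤ) : ℝ) • (1 : L2 →L[ℝ] L2)).ker

theorem mem_charSpace {q : Param} {χ : Fin 2 → ℤˣ} {v : L2} :
    v ∈ charSpace q χ ↔ ∀ i, genRight q i v = ((χ i : ℤ) : ℝ) • v := by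
  simp only [charSpace, Submodule.mem_iInf, LinearMap.mem_ker]
  exact forall_congr' fun i => sub_eq_zero

instance (q : Param) (χ : Fin 2 → ℤˣ) : (charSpace q χ).HasOrthogonalProjection := by
  have h : IsClosed (charSpace q χ : Set L2) := by
    rw [charSpace, Submodule.coe_iInf]
    exact isClosed_iInter fun i => ContinuousLinearMap.isClosed_ker _
  have : CompleteSpace (charSpace q χ) := h.completeSpace_coe
  exact .ofCompleteSpace _

theorem sign_sq (u : ℤˣ) : ((u : ℤ) : ℝ) ^ 2 = 1 := by
  rcases Int.units_eq_one_or u with rfl | rfl <;> simp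

theorem inner_eq_zero_of_ne {q : Param} {χ χ' : Fin 2 → ℤˣ} (h : χ ≠ χ') {v v' : L2}
    (hv : v ∈ charSpace q χ) (hv' : v' ∈ charSpace q χ') : inner ℝ v v' = 0 := by
  obtain ⟨i, hi⟩ := Function.ne_iff.1 h
  have h1 := inner_genRight q i v v'
  rw [mem_charSpace.1 hv, mem_charSpace.1 hv', real_inner_smul_left, real_inner_smul_right] at h1
  rcases Int.units_eq_one_or (χ i) with e | e <;> rcases Int.units_eq_one_or (χ' i) with e' | e' <;>
    rw [e, e'] at h1 hi <;> simp at h1 hi <;> linarith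

theorem gen_mem_charSpace {q : Param} {χ : Fin 2 → ℤˣ} {v : L2} (hv : v ∈ charSpace q χ)
    (i : Fin 2) : genRight q i v ∈ charSpace q χ := by
  rw [mem_charSpace.1 hv]; exact Submodule.smul_mem _ _ hv

theorem R_mem_charSpace {q : Param} {χ : Fin 2 → ℤˣ} {v : L2} (hv : v ∈ charSpace q χ)
    (y : MonoidAlgebra ℝ W) : R q y v ∈ charSpace q χ := by
  induction y using groupAlgebra_induction with
  | one => rwa [R_one]
  | add y z hy hz => rw [R_add]; exact Submodule.add_mem _ hy hz
  | smul c y hy => rw [R_smul]; exact Submodule.smul_mem _ _ hy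
  | mul y i hy => rw [R_mul_apply, R_gA]; exact gen_mem_charSpace hy i

/-- The orthogonal complement of the eigenspaces of the four characters of `W`: the part
of `L²_q W` where `st + ts` has no eigenvalues. -/
def contSpace (q : Param) : Submodule ℝ L2 := ⨅ χ, (charSpace q χ)ᗮ

theorem mem_contSpace {q : Param} {v : L2} :
    v ∈ contSpace q ↔ ∀ χ, ∀ w ∈ charSpace q χ, inner ℝ v w = 0 := by
  simp only [contSpace, Submodule.mem_iInf, Submodule.mem_orthogonal']

theorem isClosed_contSpace (q : Param) : IsClosed (contSpace q : Set L2) := by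
  rw [contSpace, Submodule.coe_iInf]
  exact isClosed_iInter fun i => Submodule.isClosed_orthogonal _

theorem fZ_mem_contSpace {q : Param} {v : L2} (hv : v ∈ contSpace q) (f : ℝ[X]) :
    fZ q f v ∈ contSpace q := by
  rw [mem_contSpace] at hv ⊢
  intro χ w hw
  rw [inner_fZ]
  exact hv χ _ (R_mem_charSpace hw _)

/-- Here `⟨T w, w⟩ = ± ⟨w, w⟩`, and `T` is isometric, so `T w = ± w`. -/
theorem mem_charSpace_of_eigenvector {q : Param} {ε : ℤˣ} {a : ℝ} {w : L2} (ha : a ^ 2 = 4)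
    (hs : genRight q 0 w = ((ε : ℤ) : ℝ) • w) (hz : Z q w = a • w) :
    ∃ χ, w ∈ charSpace q χ := by
  have hε := sign_sq ε
  set e : ℝ := ((ε : ℤ) : ℝ) with he
  have h1 : inner ℝ (genRight q 1 w) w = e * a / 2 * inner ℝ w w := by
    have h := congrArg (fun v => inner ℝ v w) hz
    simp only [Z_apply, hs, map_smul, inner_add_left, inner_genRight q 0, real_inner_smul_left,
      real_inner_smul_right] at h
    linear_combination e / 2 * h - inner ℝ (genRight q 1 w) w * hε
  have h2 : genRight q 1 w = (e * a / 2) • w := by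
    rw [← sub_eq_zero, ← inner_self_eq_zero (𝕜 := ℝ)]
    rw [inner_sub_left, inner_sub_right, inner_sub_right, real_inner_smul_left,
      real_inner_smul_left, real_inner_smul_right, real_inner_smul_right, inner_genRight_genRight,
      real_inner_comm (genRight q 1 w) w, h1]
    linear_combination -(inner ℝ w w) * (e ^ 2 / 4 * ha + hε)
  have h3 : e * a / 2 = 1 ∨ e * a / 2 = -1 := by
    have : (e * a / 2) ^ 2 = 1 := by linear_combination e ^ 2 / 4 * ha + hε
    exact (by simpa using this)
  obtain ⟨η, hη⟩ : ∃ η : ℤˣ, ((η : ℤ) : ℝ) = e * a / 2 := by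
    rcases h3 with h | h
    · exact ⟨1, by rw [h]; simp⟩
    · exact ⟨-1, by rw [h]; simp⟩
  refine ⟨![ε, η], mem_charSpace.2 fun i => ?_⟩
  fin_cases i
  · exact hs
  · change genRight q 1 w = ((η : ℤ) : ℝ) • w
    rw [hη, h2]

/-- `st + ts` has no eigenvectors in `contSpace`. -/
theorem eq_zero_of_Z_eigenvector {q : Param} {a : ℝ} {v : L2} (hv : v ∈ contSpace q)
    (hz : Z q v = a • v) : v = 0 := by
  have hZS : ∀ x, Z q (genRight q 0 x) = genRight q 0 (Z q x) := fun x => by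
    rw [Z_apply, Z_apply, map_add, genRight_genRight, genRight_genRight, add_comm]
  have key : ∀ ε : ℤˣ, v + ((ε : ℤ) : ℝ) • genRight q 0 v = 0 := fun ε => by
    have hε := sign_sq ε
    set e : ℝ := ((ε : ℤ) : ℝ) with he
    set w := v + e • genRight q 0 v with hw
    have hs : genRight q 0 w = e • w := by
      rw [hw, map_add, map_smul, genRight_genRight, smul_add, smul_smul, ← sq, hε, one_smul,
        add_comm]
    have hzw : Z q w = a • w := by
      rw [hw, map_add, map_smul, hZS, hz, map_smul, smul_add, smul_comm]
    rcases eigenvalue_sq_of_gen_eigenvector hε hs hzw with h | h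
    · exact h
    · obtain ⟨χ, hχ⟩ := mem_charSpace_of_eigenvector h hs hzw
      have h1 := mem_contSpace.1 hv χ w hχ
      rw [← inner_self_eq_zero (𝕜 := ℝ)]
      nth_rewrite 1 [hw]
      rw [inner_add_left, real_inner_smul_left, inner_genRight, hs, real_inner_smul_right, h1]
      ring
  have h1 := key 1
  have h2 := key (-1)
  simp only [Units.val_one, Int.cast_one, one_smul, Units.val_neg, Int.cast_neg, neg_smul] at h1 h2
  have : (2 : ℝ) • v = 0 := by
    rw [two_smul, ← add_zero (0 : L2)]
    nth_rewrite 1 [← h1]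
    nth_rewrite 1 [← h2]
    abel
  exact (smul_eq_zero.1 this).resolve_left two_ne_zero

/-- The linear map `f ↦ x f (st + ts)`. -/
def orbitMap (q : Param) (x : L2) : ℝ[X] →ₗ[ℝ] L2 where
  toFun f := fZ q f x
  map_add' f g := by rw [fZ, map_add, R_add]; rfl
  map_smul' c f := by rw [fZ, map_smul, R_smul]; rfl

theorem orbitMap_apply (q : Param) (x : L2) (f : ℝ[X]) : orbitMap q x f = fZ q f x := rfl

/-- Nonzero polynomials in `st + ts` are injective on `contSpace`: a vector killed by one spans
a finite-dimensional invariant subspace, which contains an eigenvector. -/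
theorem eq_zero_of_fZ_eq_zero {q : Param} {p : ℝ[X]} (hp : p ≠ 0) {v : L2} (hv : v ∈ contSpace q)
    (h : fZ q p v = 0) : v = 0 := by
  set V := LinearMap.range (orbitMap q v) with hV
  have hle : V ≤ (degreeLT ℝ p.natDegree).map (orbitMap q v) := by
    rintro _ ⟨f, rfl⟩
    refine ⟨f % p, mem_degreeLT.2 ?_, ?_⟩
    · rw [← degree_eq_natDegree hp]
      exact EuclideanDomain.mod_lt f hp
    · nth_rewrite 2 [← EuclideanDomain.mod_add_div f p]
      rw [map_add, mul_comm p, orbitMap_apply _ _ (_ * p), fZ_mul, h, map_zero, add_zero]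
  have : FiniteDimensional ℝ V := Submodule.finiteDimensional_of_le hle
  have hinv : ∀ x ∈ V, (Z q : L2 →ₗ[ℝ] L2) x ∈ V := by
    rintro _ ⟨f, rfl⟩
    refine ⟨X * f, ?_⟩
    rw [orbitMap_apply, orbitMap_apply, fZ_mul, fZ, aeval_X]; rfl
  have hsym : ((Z q : L2 →ₗ[ℝ] L2).restrict hinv).IsSymmetric := fun x y => inner_Z q x y
  by_contra hne
  have hmem : v ∈ V := ⟨1, by rw [orbitMap_apply, fZ, map_one, R_one]; rfl⟩
  have : Nontrivial V := ⟨⟨⟨v, hmem⟩, 0, fun h => hne (congrArg Subtype.val h)⟩⟩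
  obtain ⟨w, hw⟩ := hsym.hasEigenvalue_iSup_of_finiteDimensional.exists_hasEigenvector
  refine hw.2 (Subtype.ext ?_)
  obtain ⟨f, hf⟩ := w.2
  refine eq_zero_of_Z_eigenvector ?_ (congrArg Subtype.val hw.apply_eq_smul)
  rw [← hf]
  exact fZ_mem_contSpace hv f

/-- A vector orthogonal to `x p (st + ts) f (st + ts)` for all `f` is orthogonal to `x` itself,
for `x` in `contSpace`: this replaces division by `p` in the functional calculus. -/
theorem inner_eq_zero_of_forall_fZ {q : Param} {p : ℝ[X]} (hp : p ≠ 0) {x y : L2}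
    (hx : x ∈ contSpace q) (h : ∀ f, inner ℝ (fZ q p (fZ q f x)) y = 0) (f : ℝ[X]) :
    inner ℝ (fZ q f x) y = 0 := by
  set V := (LinearMap.range (orbitMap q x)).topologicalClosure with hV
  have : CompleteSpace V := (Submodule.isClosed_topologicalClosure _).completeSpace_coe
  have hVle : V ≤ contSpace q := by
    refine Submodule.topologicalClosure_minimal _ ?_ (isClosed_contSpace q)
    rintro _ ⟨f, rfl⟩
    exact fZ_mem_contSpace hx f
  have hmem : ∀ f, fZ q f x ∈ V := fun f => Submodule.le_topologicalClosure _ ⟨f, rfl⟩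
  have hinv : ∀ v ∈ V, fZ q p v ∈ V := fun v hv => by
    have : Set.MapsTo (fZ q p) (LinearMap.range (orbitMap q x))
        (LinearMap.range (orbitMap q x)) := by
      rintro _ ⟨f, rfl⟩
      exact ⟨p * f, by rw [orbitMap_apply, orbitMap_apply, fZ_mul]⟩
    exact this.closure (fZ q p).continuous hv
  set y0 := V.starProjection y with hy0
  have hy0V : y0 ∈ V := V.starProjection_apply_mem y
  have hin : ∀ v ∈ V, inner ℝ v y = inner ℝ v y0 := fun v hv => by
    have := V.starProjection_inner_eq_zero y v hv
    rw [inner_sub_left, sub_eq_zero] at this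
    rw [real_inner_comm, this, real_inner_comm]
  have h1 : fZ q p y0 = 0 := by
    have h2 : ∀ v ∈ V, inner ℝ v (fZ q p y0) = 0 := fun v hv => by
      have hcl : IsClosed {v : L2 | inner ℝ v (fZ q p y0) = 0} :=
        isClosed_eq (by fun_prop) continuous_const
      refine closure_minimal ?_ hcl hv
      rintro _ ⟨f, rfl⟩
      change inner ℝ (fZ q f x) (fZ q p y0) = 0
      rw [← inner_fZ, ← hin _ (hinv _ (hmem f)), h]
    exact inner_self_eq_zero.1 (h2 _ (hinv _ hy0V))
  have h2 := eq_zero_of_fZ_eq_zero hp (hVle hy0V) h1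
  rw [hin _ (hmem f), h2, inner_zero_right]

/-- The component of `1` in the eigenspace of the character `χ`. -/
def charPart (q : Param) (χ : Fin 2 → ℤˣ) : L2 := (charSpace q χ).starProjection (one q)

/-- The component of `1` in `contSpace`. -/
def contPart (q : Param) : L2 := one q - ∑ χ, charPart q χ

theorem charPart_mem (q : Param) (χ : Fin 2 → ℤˣ) : charPart q χ ∈ charSpace q χ :=
  Submodule.starProjection_apply_mem _ _

theorem contPart_mem (q : Param) : contPart q ∈ contSpace q := by
  rw [mem_contSpace]
  intro χ w hw
  rw [contPart, inner_sub_left, sum_inner, Finset.sum_eq_single χ]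
  · rw [← inner_sub_left]
    exact Submodule.starProjection_inner_eq_zero _ _ hw
  · intro χ' _ h
    exact inner_eq_zero_of_ne h (charPart_mem q χ') hw
  · exact fun h => absurd (Finset.mem_univ χ) h

theorem sum_charPart_add_contPart (q : Param) : ∑ χ, charPart q χ + contPart q = one q := by
  rw [contPart]; abel

/-- Left and right multiplication by a generator agree on `charPart`, because they agree
on `1` and both commute with the projection onto `charSpace`. -/
theorem genLeft_charPart (q : Param) (χ : Fin 2 → ℤˣ) (i : Fin 2) :
    genLeft q i (charPart q χ) = genRight q i (charPart q χ) := by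
  have hcomm : ∀ j x, genRight q j (genLeft q i x) = genLeft q i (genRight q j x) := fun j x =>
    (genLeft_genRight q i j x).symm
  have hL : ∀ v ∈ charSpace q χ, genLeft q i v ∈ charSpace q χ := fun v hv =>
    mem_charSpace.2 fun j => by rw [hcomm, mem_charSpace.1 hv j, map_smul]
  have h1 : (charSpace q χ).starProjection (genLeft q i (one q)) = genLeft q i (charPart q χ) := by
    refine Submodule.eq_starProjection_of_mem_of_inner_eq_zero (hL _ (charPart_mem q χ)) ?_
    intro w hw
    rw [← map_sub, inner_genLeft]
    exact Submodule.starProjection_inner_eq_zero _ _ (hL w hw)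
  have h2 : (charSpace q χ).starProjection (genRight q i (one q)) =
      genRight q i (charPart q χ) := by
    refine Submodule.eq_starProjection_of_mem_of_inner_eq_zero
      (gen_mem_charSpace (charPart_mem q χ) i) ?_
    intro w hw
    rw [← map_sub, inner_genRight]
    exact Submodule.starProjection_inner_eq_zero _ _ (gen_mem_charSpace hw i)
  rw [← h1, ← h2, genLeft_one]

theorem genLeft_contPart (q : Param) (i : Fin 2) :
    genLeft q i (contPart q) = genRight q i (contPart q) := by
  rw [contPart, map_sub, map_sub, map_sum, map_sum, genLeft_one]
  simp only [genLeft_charPart]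

/-- The functional `y ↦ ⟨x y, x⟩` on the group algebra, for the component `x` of `1` in `contSpace`;
it is a trace by `contTrace_conj`. -/
def contTrace (q : Param) (y : MonoidAlgebra ℝ W) : ℝ := inner ℝ (R q y (contPart q)) (contPart q)

theorem contTrace_add (q : Param) (y z : MonoidAlgebra ℝ W) :
    contTrace q (y + z) = contTrace q y + contTrace q z := by
  rw [contTrace, R_add, add_apply, inner_add_left]; rfl

theorem contTrace_sub (q : Param) (y z : MonoidAlgebra ℝ W) :
    contTrace q (y - z) = contTrace q y - contTrace q z := by
  rw [contTrace, R_sub, sub_apply, inner_sub_left]; rfl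

/-- Conjugation invariance of the trace; the conjugating generator is moved to the
other side by turning right into left multiplication. -/
theorem contTrace_conj (q : Param) (i : Fin 2) (y : MonoidAlgebra ℝ W) :
    contTrace q (gA i * y * gA i) = contTrace q y := by
  rw [contTrace, R_mul_apply, R_mul_apply, R_gA, inner_genRight, ← genLeft_contPart, ← genLeft_R,
    inner_genLeft_genLeft, contTrace]

theorem contTrace_gA_mul_zA (q : Param) {i j : Fin 2} (h : zA = gA j * gA i + gA i * gA j)
    (f : ℝ[X]) : contTrace q (gA i * aeval zA (X * f)) = 2 * contTrace q (gA j * aeval zA f) := by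
  have e : gA i * aeval zA (X * f) = gA i * (gA j * aeval zA f) * gA i + gA j * aeval zA f := by
    have hc := (commute_aeval_zA f (gA i)).eq
    rw [map_mul, aeval_X]
    generalize aeval zA f = φ at hc ⊢
    rw [← mul_assoc, h, mul_add, ← mul_assoc (gA i) (gA i), gA_mul_self, one_mul,
      add_mul, mul_assoc, mul_assoc, mul_assoc, mul_assoc, hc]
  rw [e, contTrace_add, contTrace_conj]
  ring

/-- The trace vanishes on `s f (st + ts)`: it is fixed by multiplication with `(st + ts) ^ 2 / 4`,
and `(st + ts) ^ 2 - 4` is injective on `contSpace`. -/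
theorem contTrace_gA_mul (q : Param) (i : Fin 2) (f : ℝ[X]) :
    contTrace q (gA i * aeval zA f) = 0 := by
  obtain ⟨j, h, h'⟩ : ∃ j, zA = gA j * gA i + gA i * gA j ∧ zA = gA i * gA j + gA j * gA i := by
    fin_cases i
    · exact ⟨1, add_comm _ _, rfl⟩
    · exact ⟨0, rfl, add_comm _ _⟩
  have hne : (X ^ 2 - C 4 : ℝ[X]) ≠ 0 := fun h => by
    have := congrArg (Polynomial.eval 0) h
    simp at this
  have e : ∀ f, contTrace q (gA i * aeval zA f)
      = inner ℝ (fZ q f (contPart q)) (genRight q i (contPart q)) := fun f => by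
    rw [contTrace, R_mul_apply, R_gA, inner_fZ, real_inner_comm]
  rw [e]
  refine inner_eq_zero_of_forall_fZ hne (contPart_mem q) (fun g => ?_) f
  have h2 := contTrace_gA_mul_zA q h (X * g)
  rw [contTrace_gA_mul_zA q h' g] at h2
  rw [← fZ_mul, ← e]
  have : (X ^ 2 - C 4) * g = X * (X * g) - C 4 * g := by ring
  rw [this, map_sub, mul_sub, contTrace_sub, h2, map_mul, aeval_C, Algebra.algebraMap_eq_smul_one,
    smul_mul_assoc, one_mul, mul_smul_comm]
  have h4 : contTrace q ((4 : ℝ) • (gA i * aeval zA g)) = 4 * contTrace q (gA i * aeval zA g) := by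
    rw [contTrace, R_smul, smul_apply, real_inner_smul_left]; rfl
  rw [h4]; ring

theorem contTrace_st_mul (q : Param) (f : ℝ[X]) :
    2 * contTrace q (gA 0 * gA 1 * aeval zA f) = contTrace q (zA * aeval zA f) := by
  have h : contTrace q (gA 0 * gA 1 * aeval zA f) = contTrace q (gA 1 * gA 0 * aeval zA f) := by
    rw [contTrace, contTrace, R_mul_apply, R_mul_apply, R_mul_apply, R_mul_apply, inner_fZ,
      R_gA, R_gA, inner_genRight, inner_genRight, real_inner_comm, ← R_gA, ← R_gA, commute_R_fZ,
      commute_R_fZ]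
  rw [zA, add_mul, contTrace_add, ← zA, ← h]; ring

/-- On the continuous part, the trace is half of the reduced trace. -/
theorem contTrace_eq (q : Param) (y : MonoidAlgebra ℝ W) (f : ℝ[X]) :
    2 * contTrace q (y * aeval zA f) = contTrace q (aeval zA ((theta y).trace * f)) := by
  obtain ⟨a, b, c, d, rfl⟩ := exists_normal_form y
  rw [trace_theta_normal_form]
  have e : (a • (1 : MonoidAlgebra ℝ W) + b • gA 0 + c • gA 1 + d • (gA 0 * gA 1)) * aeval zA f
      = aeval zA (a * f) + gA 0 * aeval zA (b * f) + gA 1 * aeval zA (c * f)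
        + gA 0 * gA 1 * aeval zA (d * f) := by
    have h : ∀ (g : ℝ[X]) (u : MonoidAlgebra ℝ W),
        g • u * aeval zA f = u * aeval zA (g * f) := fun g u => by
      rw [poly_smul, (commute_aeval_zA g u).eq, mul_assoc, map_mul]
    rw [add_mul, add_mul, add_mul, h, h, h, h, one_mul]
  rw [e, contTrace_add, contTrace_add, contTrace_add, contTrace_gA_mul, contTrace_gA_mul]
  have h2 := contTrace_st_mul q (d * f)
  have e2 : aeval zA ((2 * a + X * d) * f)
      = aeval zA (a * f) + aeval zA (a * f) + zA * aeval zA (d * f) := by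
    have : (2 * a + X * d) * f = a * f + a * f + X * (d * f) := by ring
    rw [this, map_add, map_add, map_mul _ X, aeval_X]
  rw [e2, contTrace_add, contTrace_add, ← h2]; ring

/-- The dimension `⟨pr 1, 1⟩` of the eigenspace of the character `χ`. -/
def charDim (q : Param) (χ : Fin 2 → ℤˣ) : ℝ := inner ℝ (charPart q χ) (one q)

theorem inner_charPart (q : Param) (χ χ' : Fin 2 → ℤˣ) :
    inner ℝ (charPart q χ) (charPart q χ') = if χ = χ' then charDim q χ else 0 := by
  split_ifs with h
  · subst h
    have := Submodule.starProjection_inner_eq_zero (one q) _ (charPart_mem q χ)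
    rw [inner_sub_left, sub_eq_zero] at this
    exact this.symm.trans (real_inner_comm _ _)
  · exact inner_eq_zero_of_ne h (charPart_mem q χ) (charPart_mem q χ')

theorem inner_contPart_charPart (q : Param) (χ : Fin 2 → ℤˣ) :
    inner ℝ (contPart q) (charPart q χ) = 0 :=
  mem_contSpace.1 (contPart_mem q) χ _ (charPart_mem q χ)

theorem inner_one_one (q : Param) : inner ℝ (one q) (one q) = 1 := by
  rw [one, inner_T, if_pos rfl]
  change (q 0 : ℝ) ^ 0 * (q 1 : ℝ) ^ 0 = 1
  simp

theorem inner_one_apply (q : Param) (v : L2) : inner ℝ v (one q) = v 1 := by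
  have h : Real.sqrt (qpow q 1) = 1 := by
    have := one_apply q 1
    rw [if_pos rfl, one, T, lp.single_apply, Pi.single_eq_same] at this
    exact this
  rw [real_inner_comm, one, T, lp.inner_single_left, h]
  simp

theorem inner_contPart_self (q : Param) :
    inner ℝ (contPart q) (contPart q) = 1 - ∑ χ, charDim q χ := by
  have h : inner ℝ (contPart q) (contPart q) = inner ℝ (contPart q) (one q) := by
    nth_rewrite 1 [← sum_charPart_add_contPart q]
    rw [inner_add_right, inner_sum]
    simp only [inner_contPart_charPart, Finset.sum_const_zero, zero_add]
  rw [h]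
  nth_rewrite 1 [contPart]
  rw [inner_sub_left, inner_one_one, sum_inner]
  rfl

/-- The trace of `gen i` computed on `L²_q W` and on its summands. -/
theorem sum_sign_mul_charDim (q : Param) (i : Fin 2) :
    ∑ χ, ((χ i : ℤ) : ℝ) * charDim q χ = cosQ q i := by
  have h1 : inner ℝ (genRight q i (one q)) (one q) = cosQ q i := by
    have hne : (gen i : W) ≠ 1 := by fin_cases i <;> decide
    have hm : (1 : W) ∉ descents i := by
      rw [mem_descents, one_mul]; fin_cases i <;> decide
    rw [inner_one_apply, genRight_of_not_mem hm, one_apply, one_apply, if_pos rfl, one_mul,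
      if_neg hne]
    ring
  have h2 : inner ℝ (genRight q i (contPart q)) (one q) = 0 := by
    rw [inner_genRight]
    nth_rewrite 1 [← sum_charPart_add_contPart q]
    rw [map_add, map_sum, inner_add_right, inner_sum]
    have h3 := contTrace_gA_mul q i 1
    rw [map_one, mul_one, contTrace, R_gA, real_inner_comm] at h3
    rw [h3, add_zero]
    refine Finset.sum_eq_zero fun χ _ => ?_
    exact mem_contSpace.1 (contPart_mem q) χ _ (gen_mem_charSpace (charPart_mem q χ) i)
  rw [← h1]
  nth_rewrite 1 [← sum_charPart_add_contPart q]
  rw [map_add, map_sum, inner_add_left, h2, add_zero, sum_inner]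
  refine Finset.sum_congr rfl fun χ _ => ?_
  rw [mem_charSpace.1 (charPart_mem q χ), real_inner_smul_left]; rfl

theorem sum_signs (f : (Fin 2 → ℤˣ) → ℝ) :
    ∑ χ, f χ = f ![1, 1] + f ![1, -1] + f ![-1, 1] + f ![-1, -1] := by
  rw [← (finTwoArrowEquiv ℤˣ).symm.sum_comp, Fintype.sum_prod_type, UnitsInt.univ]
  rw [Finset.sum_pair (by decide), Finset.sum_pair (by decide), Finset.sum_pair (by decide)]
  simp only [finTwoArrowEquiv_symm_apply]
  ring

/-- The eigenspace of a character has no component along `1` when the values of an eigenvector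
along the Cayley graph do not decay. -/
theorem charDim_eq_zero {q : Param} {χ : Fin 2 → ℤˣ}
    (h : 1 ≤ |((χ 0 : ℤ) - cosQ q 0) / sinQ q 0 * (((χ 1 : ℤ) - cosQ q 1) / sinQ q 1)|) :
    charDim q χ = 0 := by
  have hv := charPart_mem q χ
  rw [charDim, inner_one_apply]
  set v := charPart q χ
  rw [mem_charSpace] at hv
  set r := ((χ 0 : ℤ) - cosQ q 0) / sinQ q 0 * (((χ 1 : ℤ) - cosQ q 1) / sinQ q 1) with hr
  have hpow : ∀ n, v (stPow n) = r ^ n * v 1 := fun n => by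
    induction n with
    | zero => rw [pow_zero, one_mul]; rfl
    | succ n ih =>
      rw [← stPow_gen_gen, apply_mul_gen_of_eigenvector (hv 1) (stPow_gen_not_mem n),
        apply_mul_gen_of_eigenvector (hv 0) (stPow_not_mem n), ih, hr]
      ring
  by_contra hne
  have ht := (tendsto_coordinates_zero v stPow_injective).mul_const (v 1)⁻¹
  rw [zero_mul] at ht
  have ht' : Tendsto (fun n => r ^ n) atTop (𝓝 0) := ht.congr fun n => by
    rw [hpow, mul_assoc, mul_inv_cancel₀ hne, mul_one]
  exact absurd (tendsto_pow_atTop_nhds_zero_iff.1 ht') (not_lt.2 h)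

theorem one_sub_cosQ_div_sinQ (q : Param) (i : Fin 2) :
    (1 - cosQ q i) / sinQ q i = Real.sqrt (q i) := by
  have h := (one_add_pos q i).ne'
  have h1 := (Real.sqrt_pos.2 (q i).2).ne'
  have h2 := Real.sq_sqrt (q i).2.le
  rw [cosQ, sinQ]
  field_simp
  rw [h2]; ring

theorem neg_one_sub_cosQ_div_sinQ (q : Param) (i : Fin 2) :
    (-1 - cosQ q i) / sinQ q i = -(Real.sqrt (q i))⁻¹ := by
  have h := (one_add_pos q i).ne'
  have h1 := (Real.sqrt_pos.2 (q i).2).ne'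
  rw [cosQ, sinQ]
  field_simp
  ring

theorem charDim_pos_pos {q : Param} (h : 1 ≤ (q 0 : ℝ) * q 1) : charDim q ![1, 1] = 0 := by
  refine charDim_eq_zero ?_
  simp only [Matrix.cons_val_zero, Matrix.cons_val_one, Units.val_one, Int.cast_one,
    one_sub_cosQ_div_sinQ]
  rw [← Real.sqrt_mul (q 0).2.le, abs_of_nonneg (Real.sqrt_nonneg _)]
  exact Real.one_le_sqrt.2 h

theorem charDim_neg_neg {q : Param} (h : (q 0 : ℝ) * q 1 ≤ 1) : charDim q ![-1, -1] = 0 := by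
  refine charDim_eq_zero ?_
  simp only [Matrix.cons_val_zero, Matrix.cons_val_one, Units.val_one, Int.cast_one,
    Units.val_neg, Int.cast_neg, neg_one_sub_cosQ_div_sinQ]
  rw [neg_mul_neg, ← mul_inv, ← Real.sqrt_mul (q 0).2.le, abs_of_nonneg (by positivity)]
  have h1 := Real.sqrt_pos.2 (mul_pos (q 0).2 (q 1).2)
  exact (one_le_inv₀ h1).2 (Real.sqrt_le_one.2 h)

theorem charDim_pos_neg {q : Param} (h : (q 1 : ℝ) ≤ q 0) : charDim q ![1, -1] = 0 := by
  refine charDim_eq_zero ?_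
  simp only [Matrix.cons_val_zero, Matrix.cons_val_one, Units.val_one, Int.cast_one,
    Units.val_neg, Int.cast_neg, neg_one_sub_cosQ_div_sinQ, one_sub_cosQ_div_sinQ]
  rw [mul_neg, abs_neg, abs_of_nonneg (by positivity), ← div_eq_mul_inv]
  exact (one_le_div (Real.sqrt_pos.2 (q 1).2)).2 (Real.sqrt_le_sqrt h)

theorem charDim_neg_pos {q : Param} (h : (q 0 : ℝ) ≤ q 1) : charDim q ![-1, 1] = 0 := by
  refine charDim_eq_zero ?_
  simp only [Matrix.cons_val_zero, Matrix.cons_val_one, Units.val_one, Int.cast_one,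
    Units.val_neg, Int.cast_neg, neg_one_sub_cosQ_div_sinQ, one_sub_cosQ_div_sinQ]
  rw [neg_mul, abs_neg, abs_of_nonneg (by positivity), mul_comm, ← div_eq_mul_inv]
  exact (one_le_div (Real.sqrt_pos.2 (q 0).2)).2 (Real.sqrt_le_sqrt h)

theorem charDim_sub_charDim (q : Param) :
    charDim q ![1, 1] - charDim q ![-1, -1] =
      (1 - (q 0 : ℝ) * q 1) / ((1 + (q 0 : ℝ)) * (1 + (q 1 : ℝ))) ∧
    charDim q ![1, -1] - charDim q ![-1, 1] =
      ((q 1 : ℝ) - q 0) / ((1 + (q 0 : ℝ)) * (1 + (q 1 : ℝ))) := by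
  have h0 := sum_sign_mul_charDim q 0
  have h1 := sum_sign_mul_charDim q 1
  rw [sum_signs] at h0 h1
  simp only [Matrix.cons_val_zero, Matrix.cons_val_one, Units.val_one, Int.cast_one,
    Units.val_neg, Int.cast_neg, cosQ] at h0 h1
  have e0 := (one_add_pos q 0).ne'
  have e1 := (one_add_pos q 1).ne'
  have i1 : (1 - (q 0 : ℝ) * q 1) / ((1 + (q 0 : ℝ)) * (1 + (q 1 : ℝ)))
      = ((1 - (q 0 : ℝ)) / (1 + q 0) + (1 - (q 1 : ℝ)) / (1 + q 1)) / 2 := by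
    field_simp; ring
  have i2 : ((q 1 : ℝ) - q 0) / ((1 + (q 0 : ℝ)) * (1 + (q 1 : ℝ)))
      = ((1 - (q 0 : ℝ)) / (1 + q 0) - (1 - (q 1 : ℝ)) / (1 + q 1)) / 2 := by
    field_simp; ring
  rw [i1, i2, ← h0, ← h1]
  constructor <;> ring

/-! ### Kernels of matrices over the group algebra -/

variable {m n : ℕ}

/-- The character of the group algebra with the signs `χ` on the generators. -/
def character (χ : Fin 2 → ℤˣ) : MonoidAlgebra ℝ W →ₐ[ℝ] ℝ :=
  MonoidAlgebra.lift ℝ ℝ W (dihedralLift ((χ 0 : ℤ) : ℝ) ((χ 1 : ℤ) : ℝ)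
    (by rw [← sq, sign_sq]) (by rw [← sq, sign_sq]))

theorem character_gA (χ : Fin 2 → ℤˣ) (i : Fin 2) : character χ (gA i) = ((χ i : ℤ) : ℝ) := by
  rw [character, gA, MonoidAlgebra.lift_of]
  fin_cases i
  · exact dihedralLift_gen_zero _ _ _ _
  · exact dihedralLift_gen_one _ _ _ _

theorem R_of_mem_charSpace {q : Param} {χ : Fin 2 → ℤˣ} {v : L2} (hv : v ∈ charSpace q χ)
    (y : MonoidAlgebra ℝ W) : R q y v = character χ y • v := by
  induction y using groupAlgebra_induction with
  | one => rw [R_one, map_one, one_smul]; rfl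
  | add y z hy hz => rw [R_add, add_apply, hy, hz, map_add, add_smul]
  | smul c y hy => rw [R_smul, smul_apply, hy, map_smul, smul_smul, smul_eq_mul]
  | mul y i hy =>
    rw [R_mul_apply, hy, map_smul, R_gA, mem_charSpace.1 hv, map_mul, character_gA, smul_smul]

theorem inner_R_of_mem_charSpace {q : Param} {χ : Fin 2 → ℤˣ} {v : L2} (hv : v ∈ charSpace q χ)
    (y : MonoidAlgebra ℝ W) (x : L2) : inner ℝ v (R q y x) = character χ y * inner ℝ v x := by
  induction y using groupAlgebra_induction with
  | one => rw [R_one, map_one, one_mul]; rfl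
  | add y z hy hz => rw [R_add, add_apply, inner_add_right, hy, hz, map_add, add_mul]
  | smul c y hy => rw [R_smul, smul_apply, real_inner_smul_right, hy, map_smul, smul_eq_mul,
      mul_assoc]
  | mul y i hy =>
    rw [R_mul_apply, R_gA, ← inner_genRight, mem_charSpace.1 hv, real_inner_smul_left, hy, map_mul,
      character_gA]
    ring

theorem RMat_apply (q : Param) (M : Matrix (Fin m) (Fin n) (MonoidAlgebra ℝ W))
    (x : PiLp 2 (fun _ : Fin m => L2)) (j : Fin n) : RMat q M x j = ∑ i, R q (M i j) (x i) := by
  have h : RMat q M x j = (∑ i, (R q (M i j)).comp (PiLp.proj 2 (fun _ : Fin m => L2) i)) x := rfl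
  rw [h, sum_apply]; rfl

theorem RMat_mul_apply {l : ℕ} (q : Param) (M : Matrix (Fin m) (Fin n) (MonoidAlgebra ℝ W))
    (N : Matrix (Fin n) (Fin l) (MonoidAlgebra ℝ W)) (x : PiLp 2 (fun _ : Fin m => L2)) :
    RMat q (M * N) x = RMat q N (RMat q M x) := by
  ext k : 1
  simp only [RMat_apply, Matrix.mul_apply, R_sum, map_sum, sum_apply]
  rw [Finset.sum_comm]
  simp only [R_mul_apply]

theorem RMat_add_apply (q : Param) (M N : Matrix (Fin m) (Fin n) (MonoidAlgebra ℝ W))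
    (x : PiLp 2 (fun _ : Fin m => L2)) : RMat q (M + N) x = RMat q M x + RMat q N x := by
  ext k : 1
  simp only [RMat_apply, Matrix.add_apply, R_add, add_apply, PiLp.add_apply, Finset.sum_add_distrib]

theorem RMat_zero_apply (q : Param) (x : PiLp 2 (fun _ : Fin m => L2)) :
    RMat q (0 : Matrix (Fin m) (Fin n) (MonoidAlgebra ℝ W)) x = 0 := by
  ext k : 1
  simp only [RMat_apply, Matrix.zero_apply, R_zero, zero_apply, Finset.sum_const_zero]
  rfl

theorem RMat_algebraMap_apply (q : Param) (f : ℝ[X]) (x : PiLp 2 (fun _ : Fin m => L2))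
    (j : Fin m) :
    RMat q (algebraMap ℝ[X] (Matrix (Fin m) (Fin m) (MonoidAlgebra ℝ W)) f) x j
      = fZ q f (x j) := by
  rw [RMat_apply, Finset.sum_eq_single j]
  · rw [Matrix.algebraMap_matrix_apply, if_pos rfl, algebraMap_poly]
  · intro i _ h
    rw [Matrix.algebraMap_matrix_apply, if_neg h, R_zero]; rfl
  · exact fun h => absurd (Finset.mem_univ j) h

theorem exists_adjoint_matrix (M : Matrix (Fin m) (Fin n) (MonoidAlgebra ℝ W)) :
    ∃ M' : Matrix (Fin n) (Fin m) (MonoidAlgebra ℝ W), ∀ (q : Param) x y,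
      inner ℝ (RMat q M x) y = inner ℝ x (RMat q M' y) := by
  choose M' hM' using fun i j => exists_adjoint (M i j)
  refine ⟨Matrix.of fun j i => M' i j, fun q x y => ?_⟩
  simp only [PiLp.inner_apply, RMat_apply, Matrix.of_apply, sum_inner, hM']
  rw [Finset.sum_comm]
  refine Finset.sum_congr rfl fun i _ => ?_
  rw [inner_sum]

/-- The vector with `v` in position `i` and `0` elsewhere. -/
def emb (i : Fin m) (v : L2) : PiLp 2 (fun _ : Fin m => L2) := WithLp.toLp 2 (Pi.single i v)

theorem emb_apply (i j : Fin m) (v : L2) : emb i v j = if j = i then v else 0 := by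
  change (Pi.single i v : Fin m → L2) j = _
  rw [Pi.single_apply]

theorem inner_emb (x : PiLp 2 (fun _ : Fin m => L2)) (i : Fin m) (v : L2) :
    inner ℝ x (emb i v) = inner ℝ (x i) v := by
  rw [PiLp.inner_apply, Finset.sum_eq_single i]
  · rw [emb_apply, if_pos rfl]
  · intro j _ h
    rw [emb_apply, if_neg h, inner_zero_right]
  · exact fun h => absurd (Finset.mem_univ i) h

theorem RMat_emb_apply (q : Param) (M : Matrix (Fin m) (Fin n) (MonoidAlgebra ℝ W)) (i : Fin m)
    (v : L2) (j : Fin n) : RMat q M (emb i v) j = R q (M i j) v := by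
  rw [RMat_apply, Finset.sum_eq_single i]
  · rw [emb_apply, if_pos rfl]
  · intro k _ h
    rw [emb_apply, if_neg h, map_zero]
  · exact fun h => absurd (Finset.mem_univ i) h

theorem emb_add (i : Fin m) (u v : L2) : emb i (u + v) = emb i u + emb i v := by
  rw [emb, Pi.single_add]; rfl

theorem emb_sum {ι : Type*} (i : Fin m) (s : Finset ι) (u : ι → L2) :
    emb i (∑ k ∈ s, u k) = ∑ k ∈ s, emb i (u k) :=
  map_sum (AddMonoidHom.mk' (emb i) (emb_add i)) u s

section SelfAdjoint

variable {q : Param} {B : Matrix (Fin m) (Fin m) (MonoidAlgebra ℝ W)}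

theorem inner_RMat_algebraMap (f : ℝ[X]) (x y : PiLp 2 (fun _ : Fin m => L2)) :
    inner ℝ (RMat q (algebraMap ℝ[X] (Matrix (Fin m) (Fin m) (MonoidAlgebra ℝ W)) f) x) y =
      inner ℝ x (RMat q (algebraMap ℝ[X] (Matrix (Fin m) (Fin m) (MonoidAlgebra ℝ W)) f) y) := by
  simp only [PiLp.inner_apply, RMat_algebraMap_apply, inner_fZ]

theorem inner_RMat_aeval (hB : ∀ x y, inner ℝ (RMat q B x) y = inner ℝ x (RMat q B y))
    (g : ℝ[X][X]) (x y : PiLp 2 (fun _ : Fin m => L2)) :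
    inner ℝ (RMat q (aeval B g) x) y = inner ℝ x (RMat q (aeval B g) y) := by
  induction g using Polynomial.induction_on generalizing x y with
  | C a => rw [aeval_C]; exact inner_RMat_algebraMap a x y
  | add f g hf hg =>
    rw [map_add, RMat_add_apply, RMat_add_apply, inner_add_left, inner_add_right, hf, hg]
  | monomial n a h =>
    have e : ∀ x, RMat q (aeval B (C a * X ^ (n + 1))) x
        = RMat q B (RMat q (aeval B (C a * X ^ n)) x) :=
      fun x => by rw [pow_succ, ← mul_assoc, map_mul, RMat_mul_apply, aeval_X]
    have e' : ∀ x, RMat q (aeval B (C a * X ^ (n + 1))) x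
        = RMat q (aeval B (C a * X ^ n)) (RMat q B x) :=
      fun x => by rw [pow_succ, ← mul_assoc, mul_comm _ X, map_mul, RMat_mul_apply, aeval_X]
    rw [e, e', hB, h]

theorem RMat_eq_zero_of_pow (hB : ∀ x y, inner ℝ (RMat q B x) y = inner ℝ x (RMat q B y))
    {k : ℕ} {x : PiLp 2 (fun _ : Fin m => L2)} (h : RMat q (B ^ (k + 1)) x = 0) :
    RMat q B x = 0 := by
  induction k with
  | zero => rwa [zero_add, pow_one] at h
  | succ k ih =>
    apply ih
    rw [← inner_self_eq_zero (𝕜 := ℝ)]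
    nth_rewrite 2 [pow_succ]
    rw [RMat_mul_apply, ← hB, ← RMat_mul_apply, ← pow_succ, h, inner_zero_left]

/-- Up to the factor `g 0`, the matrix `g B` acts as the orthogonal projection onto the kernel of
the self-adjoint matrix `B`. -/
theorem RMat_aeval_eq (hB : ∀ x y, inner ℝ (RMat q B x) y = inner ℝ x (RMat q B y))
    {g : ℝ[X][X]} {k : ℕ} (hk : B ^ k * aeval B g = 0)
    {V : Submodule ℝ (PiLp 2 (fun _ : Fin m => L2))} [V.HasOrthogonalProjection]
    (hV : ∀ x, x ∈ V ↔ RMat q B x = 0) (x : PiLp 2 (fun _ : Fin m => L2)) :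
    RMat q (aeval B g) x = RMat q (algebraMap ℝ[X] _ (g.coeff 0)) (V.starProjection x) := by
  have h1 : ∀ v ∈ V, RMat q (aeval B g) v = RMat q (algebraMap ℝ[X] _ (g.coeff 0)) v := by
    intro v hv
    nth_rewrite 1 [← Polynomial.X_mul_divX_add g]
    rw [map_add, map_mul, aeval_X, aeval_C, RMat_add_apply, RMat_mul_apply, (hV v).1 hv, map_zero,
      zero_add]
  have hpV : ∀ v ∈ V, RMat q (algebraMap ℝ[X] _ (g.coeff 0)) v ∈ V := by
    intro v hv
    rw [hV, ← RMat_mul_apply, Algebra.commutes, RMat_mul_apply, (hV v).1 hv, map_zero]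
  have h2 : ∀ v ∈ Vᗮ, RMat q (aeval B g) v = 0 := by
    intro v hv
    have hmem : RMat q (aeval B g) v ∈ V := by
      rw [hV]
      apply RMat_eq_zero_of_pow hB (k := k)
      have hc : aeval B g * B ^ (k + 1) = 0 := by
        have : aeval B g * B ^ (k + 1) = B * (B ^ k * aeval B g) := by
          rw [← mul_assoc, ← pow_succ', ← aeval_X_pow (R := ℝ[X]) B, ← map_mul, ← map_mul, mul_comm]
        rw [this, hk, mul_zero]
      rw [← RMat_mul_apply, hc, RMat_zero_apply]
    have hort : ∀ w ∈ V, inner ℝ (RMat q (aeval B g) v) w = 0 := by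
      intro w hw
      rw [inner_RMat_aeval hB, h1 w hw]
      exact Submodule.inner_left_of_mem_orthogonal (hpV w hw) hv
    exact inner_self_eq_zero.1 (hort _ hmem)
  have hx : x = V.starProjection x + (x - V.starProjection x) := by abel
  nth_rewrite 1 [hx]
  rw [map_add, h1 _ (Submodule.starProjection_apply_mem _ _),
    h2 _ (Submodule.sub_starProjection_mem_orthogonal x), add_zero]

/-- The contribution of the continuous part to the dimension of the kernel: half of the
reduced trace of the projection. -/
theorem sum_inner_contPart (hB : ∀ x y, inner ℝ (RMat q B x) y = inner ℝ x (RMat q B y))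
    {g : ℝ[X][X]} {k c : ℕ} (h0 : g.coeff 0 ≠ 0) (hk : B ^ k * aeval B g = 0)
    (hc : (theta (aeval B g).trace).trace = c * g.coeff 0)
    {V : Submodule ℝ (PiLp 2 (fun _ : Fin m => L2))} [V.HasOrthogonalProjection]
    (hV : ∀ x, x ∈ V ↔ RMat q B x = 0) :
    ∑ i, inner ℝ (V.starProjection (emb i (contPart q))) (emb i (contPart q))
      = (c : ℝ) / 2 * inner ℝ (contPart q) (contPart q) := by
  set x := contPart q with hx
  -- the vector representing the functional whose vanishing at `x` is the claim
  set y : L2 := ∑ i, V.starProjection (emb i x) i - ((c : ℝ) / 2) • x with hy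
  have hker : ∀ f, inner ℝ (fZ q (g.coeff 0) (fZ q f x)) y = 0 := by
    intro f
    have h1 : ∀ i, inner ℝ (fZ q (g.coeff 0) (fZ q f x)) (V.starProjection (emb i x) i)
        = inner ℝ (R q (aeval B g i i) (fZ q f x)) x := by
      intro i
      rw [inner_fZ, ← RMat_algebraMap_apply, ← RMat_aeval_eq hB hk hV, RMat_emb_apply,
        inner_fZ, ← commute_R_fZ, real_inner_comm]
    have h2 : ∑ i, R q (aeval B g i i) (fZ q f x) = R q (aeval B g).trace (fZ q f x) := by
      rw [Matrix.trace, R_sum, sum_apply]; rfl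
    have h3 := contTrace_eq q (aeval B g).trace f
    have h4 : fZ q (c * g.coeff 0 * f) x = (c : ℝ) • fZ q (g.coeff 0) (fZ q f x) := by
      rw [mul_assoc, ← fZ_mul, ← map_natCast (C : ℝ →+* ℝ[X]) c, fZ_mul, fZ, aeval_C,
        Algebra.algebraMap_eq_smul_one, R_smul, R_one]
      rfl
    rw [hc, contTrace, contTrace, R_mul_apply, ← hx, ← commute_R_fZ] at h3
    change _ = inner ℝ (fZ q (c * g.coeff 0 * f) x) x at h3
    rw [h4, real_inner_smul_left] at h3
    rw [hy, inner_sub_right, inner_sum, real_inner_smul_right, Finset.sum_congr rfl fun i _ => h1 i,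
      ← sum_inner, h2]
    linear_combination h3 / 2
  have := inner_eq_zero_of_forall_fZ h0 (contPart_mem q) hker 1
  rw [fZ, map_one, R_one] at this
  change inner ℝ x y = 0 at this
  rw [hy, inner_sub_right, inner_sum, real_inner_smul_right, sub_eq_zero] at this
  rw [← this]
  refine Finset.sum_congr rfl fun i _ => ?_
  rw [inner_emb, real_inner_comm]

end SelfAdjoint

/-- The kernel of the scalar matrix that is the image of `M` under the character `χ`. -/
def charKer (M : Matrix (Fin m) (Fin n) (MonoidAlgebra ℝ W)) (χ : Fin 2 → ℤˣ) :
    Submodule ℝ (EuclideanSpace ℝ (Fin m)) where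
  carrier := {a | ∀ j, ∑ i, a i * character χ (M i j) = 0}
  add_mem' {a b} ha hb j := by
    simp only [PiLp.add_apply, add_mul, Finset.sum_add_distrib, ha j, hb j, add_zero]
  zero_mem' j := by simp
  smul_mem' r a ha j := by
    simp only [PiLp.smul_apply, smul_eq_mul, mul_assoc, ← Finset.mul_sum, ha j, mul_zero]

/-- The vector `a ⊗ u` with components `a i • u`. -/
def tens (a : EuclideanSpace ℝ (Fin m)) (u : L2) : PiLp 2 (fun _ : Fin m => L2) :=
  WithLp.toLp 2 fun i => a i • u

theorem tens_single (i : Fin m) (u : L2) : tens (EuclideanSpace.single i (1 : ℝ)) u = emb i u := by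
  ext j : 1
  rw [emb_apply]
  change (EuclideanSpace.single i (1 : ℝ)) j • u = _
  simp only [PiLp.single_apply]
  split_ifs <;> simp

/-- On vectors from the eigenspace of a character the projection onto the kernel of `M` is given by
the projection onto the kernel of the image of `M` under that character. -/
theorem starProjection_tens {q : Param} (M : Matrix (Fin m) (Fin n) (MonoidAlgebra ℝ W))
    [((RMat q M).ker).HasOrthogonalProjection] {χ : Fin 2 → ℤˣ} {u : L2} (hu : u ∈ charSpace q χ)
    (a : EuclideanSpace ℝ (Fin m)) :
    (RMat q M).ker.starProjection (tens a u) = tens ((charKer M χ).starProjection a) u := by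
  refine Submodule.eq_starProjection_of_mem_of_inner_eq_zero ?_ ?_
  · have h : (charKer M χ).starProjection a ∈ charKer M χ := Submodule.starProjection_apply_mem _ _
    rw [LinearMap.mem_ker]
    refine PiLp.ext fun j => ?_
    change RMat q M _ j = 0
    rw [RMat_apply]
    have : ∀ i, R q (M i j) (tens ((charKer M χ).starProjection a) u i)
        = ((charKer M χ).starProjection a i * character χ (M i j)) • u := fun i => by
      change R q (M i j) ((charKer M χ).starProjection a i • u) = _
      rw [map_smul, R_of_mem_charSpace hu, smul_smul]
    rw [Finset.sum_congr rfl fun i _ => this i, ← Finset.sum_smul, h j, zero_smul]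
  · intro y hy
    have hmem : WithLp.toLp 2 (fun i => inner ℝ u (y i)) ∈ charKer M χ := fun j => by
      have h : RMat q M y j = 0 := by
        have : RMat q M y = 0 := hy
        rw [this]; rfl
      rw [RMat_apply] at h
      have h' := congrArg (fun v => inner ℝ u v) h
      simp only [inner_sum, inner_R_of_mem_charSpace hu, inner_zero_right] at h'
      simp only [← h']
      exact Finset.sum_congr rfl fun i _ => mul_comm _ _
    have h0 := Submodule.starProjection_inner_eq_zero a _ hmem
    rw [PiLp.inner_apply] at h0 ⊢
    rw [← h0]
    refine Finset.sum_congr rfl fun i _ => ?_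
    change inner ℝ (a i • u - (charKer M χ).starProjection a i • u) (y i)
      = inner ℝ (a i - (charKer M χ).starProjection a i) (inner ℝ u (y i))
    rw [← sub_smul, real_inner_smul_left]
    exact mul_comm _ _

/-- The trace of an orthogonal projection is its rank. -/
theorem sum_starProjection_single (V : Submodule ℝ (EuclideanSpace ℝ (Fin m))) :
    ∑ i, V.starProjection (EuclideanSpace.single i 1) i = (Module.finrank ℝ V : ℝ) := by
  have hid : IsIdempotentElem V.starProjection.toLinearMap := by
    have h := (Submodule.isIdempotentElem_starProjection V).eq
    exact congrArg ContinuousLinearMap.toLinearMap h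
  have h1 := (LinearMap.IsIdempotentElem.isProj_range _ hid).trace
  rw [LinearMap.trace_eq_sum_inner _ (EuclideanSpace.basisFun (Fin m) ℝ)] at h1
  have h2 : LinearMap.range V.starProjection.toLinearMap = V :=
    Submodule.range_starProjection V
  rw [h2] at h1
  rw [← h1]
  refine Finset.sum_congr rfl fun i _ => ?_
  rw [EuclideanSpace.basisFun_apply, EuclideanSpace.inner_single_left]
  simp

/-- The components of `1` along the characters of `W` and along `contSpace` contribute
separately to the dimension. -/
theorem inner_starProjection_emb_one {q : Param} (M : Matrix (Fin m) (Fin n) (MonoidAlgebra ℝ W))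
    [((RMat q M).ker).HasOrthogonalProjection] (i : Fin m) :
    inner ℝ ((RMat q M).ker.starProjection (emb i (one q))) (emb i (one q)) =
      ∑ χ, (charKer M χ).starProjection (EuclideanSpace.single i 1) i * charDim q χ
      + inner ℝ ((RMat q M).ker.starProjection (emb i (contPart q))) (emb i (contPart q)) := by
  set P := (RMat q M).ker.starProjection with hP
  have hchar : ∀ χ, P (emb i (charPart q χ)) i
      = (charKer M χ).starProjection (EuclideanSpace.single i 1) i • charPart q χ := fun χ => by
    rw [← tens_single, starProjection_tens M (charPart_mem q χ)]; rfl
  have hcross : ∀ χ, inner ℝ (P (emb i (contPart q))) (emb i (charPart q χ)) = 0 := fun χ => by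
    rw [hP, Submodule.inner_starProjection_left_eq_right, real_inner_comm, inner_emb, ← hP, hchar,
      real_inner_smul_left, real_inner_comm, inner_contPart_charPart, mul_zero]
  rw [← sum_charPart_add_contPart q, emb_add, emb_sum, map_add, map_sum, inner_add_left,
    inner_add_right, inner_add_right, inner_sum (𝕜 := ℝ) _ _ (P (emb i (contPart q)))]
  simp only [hcross, Finset.sum_const_zero, zero_add]
  congr 1
  simp only [sum_inner, inner_sum, inner_emb, hchar, real_inner_smul_left, inner_charPart]
  have hz : ∀ χ, inner ℝ (charPart q χ) (contPart q) = 0 := fun χ => by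
    rw [real_inner_comm, inner_contPart_charPart]
  simp only [hz, mul_zero, Finset.sum_const_zero, add_zero, mul_ite, Finset.sum_ite_eq',
    Finset.mem_univ, if_true]

/-- The dimension of the kernel of a matrix, as a combination of the dimensions of the eigenspaces
of the four characters and of the continuous part. -/
theorem exists_dimKer_eq (M : Matrix (Fin m) (Fin n) (MonoidAlgebra ℝ W)) :
    ∃ c : ℕ, ∀ q, dimKer M q =
      ∑ χ, (Module.finrank ℝ (charKer M χ) : ℝ) * charDim q χ
        + (c : ℝ) / 2 * (1 - ∑ χ, charDim q χ) := by
  obtain ⟨M', hM'⟩ := exists_adjoint_matrix M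
  obtain ⟨g, k, c, h0, hk, hc⟩ := exists_polynomial_of_matrix (M * M')
  refine ⟨c, fun q => ?_⟩
  have hB : ∀ x y, inner ℝ (RMat q (M * M') x) y = inner ℝ x (RMat q (M * M') y) := fun x y => by
    rw [RMat_mul_apply, RMat_mul_apply, ← hM', real_inner_comm, ← hM', real_inner_comm]
  have hV : ∀ x, x ∈ (RMat q M).ker ↔ RMat q (M * M') x = 0 := fun x => by
    rw [LinearMap.mem_ker, RMat_mul_apply]
    refine ⟨fun h => ?_, fun h => ?_⟩
    · have : RMat q M x = 0 := h
      rw [this, map_zero]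
    · change RMat q M x = 0
      rw [← inner_self_eq_zero (𝕜 := ℝ), hM', h, inner_zero_right]
  rw [dimKer, dimW]
  have hstd : ∀ i : Fin m, stdVec q i = emb i (one q) := fun i => rfl
  simp only [hstd, inner_starProjection_emb_one]
  rw [Finset.sum_add_distrib, sum_inner_contPart hB h0 hk hc hV, inner_contPart_self,
    Finset.sum_comm]
  simp only [← Finset.sum_mul, sum_starProjection_single]

/-! ### The eigenspaces of `st` in `L²_q G` -/

theorem R_st_apply (q : Param) (x : L2) : R q st x = genRight q 1 (genRight q 0 x) := by
  have : st = gA 0 * gA 1 := map_mul _ _ _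
  rw [this, R_mul_apply, R_gA, R_gA]

theorem mem_K {q : Param} {c : ℝ} {x : L2G q} : x ∈ K q c ↔ R q st x = c • (x : L2) := by
  rw [LinearMap.mem_ker]
  exact sub_eq_zero

/-- The component of `1` in the eigenspace of `st` for the sign `η`. -/
def stPart (q : Param) (η : ℤˣ) : L2 := charPart q ![1, η] + charPart q ![-1, -η]

theorem R_st_of_mem {q : Param} {χ : Fin 2 → ℤˣ} {v : L2} (hv : v ∈ charSpace q χ) :
    R q st v = (((χ 0 * χ 1 : ℤˣ) : ℤ) : ℝ) • v := by
  rw [R_st_apply, mem_charSpace.1 hv, map_smul, mem_charSpace.1 hv, smul_smul]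
  push_cast; rfl

theorem R_st_stPart (q : Param) (η : ℤˣ) : R q st (stPart q η) = ((η : ℤ) : ℝ) • stPart q η := by
  rw [stPart, map_add, R_st_of_mem (charPart_mem q _), R_st_of_mem (charPart_mem q _), smul_add]
  simp

/-- An eigenvector of `st` with eigenvalue a sign is a sum of eigenvectors of `s`, on which `t`
also acts by a sign. -/
theorem exists_add_of_R_st_eq {q : Param} {η : ℤˣ} {w : L2} (h : R q st w = ((η : ℤ) : ℝ) • w) :
    ∃ w₁ ∈ charSpace q ![1, η], ∃ w₂ ∈ charSpace q ![-1, -η], w = w₁ + w₂ := by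
  rw [R_st_apply] at h
  have h' : genRight q 1 w = ((η : ℤ) : ℝ) • genRight q 0 w := by
    have h1 := congrArg (genRight q 1) h
    rw [genRight_genRight, map_smul] at h1
    rw [h1, smul_smul, ← sq, sign_sq, one_smul]
  refine ⟨(1 / 2 : ℝ) • (w + genRight q 0 w), mem_charSpace.2 fun i => ?_,
    (1 / 2 : ℝ) • (w - genRight q 0 w), mem_charSpace.2 fun i => ?_, by module⟩
  · fin_cases i
    · simp only [Fin.zero_eta, map_smul, map_add, genRight_genRight, Matrix.cons_val_zero,
        Units.val_one, Int.cast_one]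
      module
    · simp only [Fin.mk_one, map_smul, map_add, h, h', Matrix.cons_val_one,
        Matrix.cons_val_fin_one]
      module
  · fin_cases i
    · simp only [Fin.zero_eta, map_smul, map_sub, genRight_genRight, Matrix.cons_val_zero,
        Units.val_neg, Units.val_one, Int.cast_neg, Int.cast_one]
      module
    · simp only [Fin.mk_one, map_smul, map_sub, h, h', Matrix.cons_val_one,
        Matrix.cons_val_fin_one, Units.val_neg, Int.cast_neg]
      module

theorem inner_one_sub_stPart {q : Param} {η : ℤˣ} {w : L2}
    (h : R q st w = ((η : ℤ) : ℝ) • w) : inner ℝ (one q - stPart q η) w = 0 := by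
  obtain ⟨w₁, h₁, w₂, h₂, rfl⟩ := exists_add_of_R_st_eq h
  have hne : (![1, η] : Fin 2 → ℤˣ) ≠ ![-1, -η] := fun h => by
    have h0 : (1 : ℤˣ) = -1 := congrFun h 0
    exact absurd h0 (by decide)
  have e₁ := Submodule.starProjection_inner_eq_zero (one q) _ h₁
  have e₂ := Submodule.starProjection_inner_eq_zero (one q) _ h₂
  have e₃ := inner_eq_zero_of_ne hne (charPart_mem q _) h₂
  have e₄ := inner_eq_zero_of_ne hne.symm (charPart_mem q _) h₁
  rw [inner_sub_left] at e₁ e₂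
  change _ - inner ℝ (charPart q _) _ = 0 at e₁ e₂
  rw [stPart, inner_sub_left, inner_add_left, inner_add_right, inner_add_right, inner_add_right]
  linarith

/-- The projection of `1` to an eigenspace of `st` is a limit of averages over powers of `st`. -/
theorem stPart_mem_L2G (q : Param) (η : ℤˣ) : stPart q η ∈ L2G q := by
  set f : L2 →L[ℝ] L2 := ((η : ℤ) : ℝ) • R q st with hf
  have hη := sign_sq η
  have hfx : ∀ x, f x = ((η : ℤ) : ℝ) • R q st x := fun x => rfl
  have hnorm : ‖f‖ ≤ 1 := by
    refine ContinuousLinearMap.opNorm_le_bound _ zero_le_one fun x => ?_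
    have : ‖((η : ℤ) : ℝ)‖ = 1 := by
      rw [Real.norm_eq_abs]; rcases Int.units_eq_one_or η with rfl | rfl <;> simp
    rw [hfx, norm_smul, this, R_st_apply, norm_genRight, norm_genRight]
  have hfix : ∀ w, f w = w ↔ R q st w = ((η : ℤ) : ℝ) • w := fun w => by
    rw [hfx]
    constructor
    · intro h
      nth_rewrite 2 [← h]
      rw [smul_smul, ← sq, hη, one_smul]
    · intro h
      rw [h, smul_smul, ← sq, hη, one_smul]
  have hlim := f.tendsto_birkhoffAverage_orthogonalProjection hnorm (one q)
  have hproj : ((LinearMap.eqLocus (f : L2 →ₗ[ℝ] L2) (1 : L2 →L[ℝ] L2)).orthogonalProjectionOnto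
      (one q) : L2) = stPart q η := by
    refine Submodule.eq_starProjection_of_mem_of_inner_eq_zero ?_ ?_
    · exact (hfix _).2 (R_st_stPart q η)
    · exact fun w hw => inner_one_sub_stPart ((hfix w).1 hw)
  rw [hproj] at hlim
  set V := Submodule.span ℝ {x | ∃ g ∈ G, x = R q (MonoidAlgebra.of ℝ W g) (one q)} with hV
  have hinv : ∀ x ∈ V, f x ∈ V := fun x hx => by
    rw [hfx]
    refine Submodule.smul_mem _ _ ?_
    induction hx using Submodule.span_induction with
    | mem x hx =>
      obtain ⟨g, hg, rfl⟩ := hx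
      refine Submodule.subset_span ⟨g * (gen 0 * gen 1),
        G.mul_mem hg (Subgroup.mem_zpowers _), ?_⟩
      rw [map_mul, R_mul_apply]; rfl
    | zero => rw [map_zero]; exact Submodule.zero_mem _
    | add x y _ _ hx hy => rw [map_add]; exact Submodule.add_mem _ hx hy
    | smul c x _ hx => rw [map_smul]; exact Submodule.smul_mem _ _ hx
  have hiter : ∀ n, f^[n] (one q) ∈ V := fun n => by
    induction n with
    | zero => exact Submodule.subset_span ⟨1, G.one_mem, by rw [map_one, R_one]; rfl⟩
    | succ n ih => rw [Function.iterate_succ_apply']; exact hinv _ ih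
  refine mem_closure_of_tendsto hlim (Eventually.of_forall fun n => ?_)
  exact Submodule.smul_mem _ _ (Submodule.sum_mem _ fun k _ => hiter k)

theorem dimG_K (q : Param) (η : ℤˣ) [(K q ((η : ℤ) : ℝ)).HasOrthogonalProjection] :
    dimG q (K q ((η : ℤ) : ℝ)) = charDim q ![1, η] + charDim q ![-1, -η] := by
  have h : (K q ((η : ℤ) : ℝ)).starProjection (oneG q) = ⟨stPart q η, stPart_mem_L2G q η⟩ := by
    refine Submodule.eq_starProjection_of_mem_of_inner_eq_zero ?_ ?_
    · exact mem_K.2 (R_st_stPart q η)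
    · exact fun w hw => inner_one_sub_stPart (mem_K.1 hw)
  rw [dimG, h]
  change inner ℝ (stPart q η) (one q) = _
  rw [stPart, inner_add_left]; rfl

theorem dimG_K_one (q : Param) [(K q 1).HasOrthogonalProjection] :
    dimG q (K q 1) = charDim q ![1, 1] + charDim q ![-1, -1] := by
  have e : K q 1 = K q (((1 : ℤˣ) : ℤ) : ℝ) := by simp
  have : (K q (((1 : ℤˣ) : ℤ) : ℝ)).HasOrthogonalProjection := e ▸ inferInstance
  rw [← dimG_K q 1]
  congr 1

theorem dimG_K_neg_one (q : Param) [(K q (-1)).HasOrthogonalProjection] :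
    dimG q (K q (-1)) = charDim q ![1, -1] + charDim q ![-1, 1] := by
  have e : K q (-1) = K q (((-1 : ℤˣ) : ℤ) : ℝ) := by simp
  have : (K q (((-1 : ℤˣ) : ℤ) : ℝ)).HasOrthogonalProjection := e ▸ inferInstance
  have h := dimG_K q (-1)
  rw [neg_neg] at h
  rw [← h]
  congr 1

theorem dimG_Kempty (q : Param) : dimG q (Kempty q) = 1 - ∑ χ, charDim q χ := by
  have hpm : ∀ η : ℤˣ, (⟨stPart q η, stPart_mem_L2G q η⟩ : L2G q) ∈ K q ((η : ℤ) : ℝ) :=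
    fun η => mem_K.2 (R_st_stPart q η)
  have hle : ∀ η : ℤˣ, K q ((η : ℤ) : ℝ) ≤ K q 1 ⊔ K q (-1) := fun η => by
    rcases Int.units_eq_one_or η with rfl | rfl
    · simp only [Units.val_one, Int.cast_one]; exact le_sup_left
    · simp only [Units.val_neg, Units.val_one, Int.cast_neg, Int.cast_one]; exact le_sup_right
  have h : (Kempty q).starProjection (oneG q) = oneG q - ⟨stPart q 1, stPart_mem_L2G q 1⟩
      - ⟨stPart q (-1), stPart_mem_L2G q (-1)⟩ := by
    refine Submodule.eq_starProjection_of_mem_of_inner_eq_zero ?_ ?_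
    · have hcross : ∀ (η : ℤˣ) (w : L2), R q st w = (((-η : ℤˣ) : ℤ) : ℝ) • w →
          inner ℝ (stPart q η) w = 0 := fun η w hw => by
        have h1 : inner ℝ (R q st (stPart q η)) (R q st w) = inner ℝ (stPart q η) w := by
          rw [R_st_apply, R_st_apply, inner_genRight_genRight, inner_genRight_genRight]
        rw [hw, R_st_stPart, real_inner_smul_left, real_inner_smul_right] at h1
        have hη := sign_sq η
        push_cast at h1
        linear_combination -h1 / 2 - hη * inner ℝ (stPart q η) w / 2
      rw [Kempty, ← Submodule.inf_orthogonal]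
      refine ⟨(Submodule.mem_orthogonal' _ _).2 fun w hw => ?_,
        (Submodule.mem_orthogonal' _ _).2 fun w hw => ?_⟩
      · have hw1 : R q st w = (((1 : ℤˣ) : ℤ) : ℝ) • (w : L2) := by rw [mem_K.1 hw]; simp
        change inner ℝ (one q - stPart q 1 - stPart q (-1)) (w : L2) = 0
        rw [inner_sub_left, inner_one_sub_stPart hw1, hcross (-1) w (by rwa [neg_neg]), sub_zero]
      · have hw1 : R q st w = (((-1 : ℤˣ) : ℤ) : ℝ) • (w : L2) := by rw [mem_K.1 hw]; simp
        change inner ℝ (one q - stPart q 1 - stPart q (-1)) (w : L2) = 0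
        rw [sub_right_comm, inner_sub_left, inner_one_sub_stPart hw1, hcross 1 w hw1, sub_zero]
    · intro w hw
      have hw' : ∀ η : ℤˣ, inner ℝ (⟨stPart q η, stPart_mem_L2G q η⟩ : L2G q) w = 0 := fun η =>
        Submodule.inner_right_of_mem_orthogonal (hle η (hpm η)) hw
      have e : oneG q - (oneG q - ⟨stPart q 1, stPart_mem_L2G q 1⟩
          - ⟨stPart q (-1), stPart_mem_L2G q (-1)⟩ : L2G q) =
          ⟨stPart q 1, stPart_mem_L2G q 1⟩ + ⟨stPart q (-1), stPart_mem_L2G q (-1)⟩ := by abel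
      rw [e, inner_add_left, hw', hw', add_zero]
  rw [dimG, h]
  change inner ℝ (one q - stPart q 1 - stPart q (-1)) (one q) = _
  rw [inner_sub_left, inner_sub_left, inner_one_one, stPart, stPart, inner_add_left, inner_add_left,
    sum_signs, neg_neg]
  simp only [charDim]
  ring

/-! ### Dependence on the parameters -/

theorem one_add_mul_pos (q : Param) : 0 < (1 + (q 0 : ℝ)) * (1 + (q 1 : ℝ)) :=
  mul_pos (one_add_pos q 0) (one_add_pos q 1)

theorem charDim_pos_pos_eq (q : Param) : charDim q ![1, 1] =
    max (1 - (q 0 : ℝ) * q 1) 0 / ((1 + (q 0 : ℝ)) * (1 + (q 1 : ℝ))) := by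
  have h := (charDim_sub_charDim q).1
  rcases le_total ((q 0 : ℝ) * q 1) 1 with h1 | h1
  · rw [charDim_neg_neg h1, sub_zero] at h
    rw [h, max_eq_left (by linarith)]
  · rw [charDim_pos_pos h1, max_eq_right (by linarith), zero_div]

theorem charDim_neg_neg_eq (q : Param) : charDim q ![-1, -1] =
    max ((q 0 : ℝ) * q 1 - 1) 0 / ((1 + (q 0 : ℝ)) * (1 + (q 1 : ℝ))) := by
  have h := (charDim_sub_charDim q).1
  rcases le_total ((q 0 : ℝ) * q 1) 1 with h1 | h1
  · rw [charDim_neg_neg h1, max_eq_right (by linarith), zero_div]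
  · rw [charDim_pos_pos h1, zero_sub, neg_eq_iff_eq_neg, ← neg_div, neg_sub] at h
    rw [h, max_eq_left (by linarith)]

theorem charDim_pos_neg_eq (q : Param) : charDim q ![1, -1] =
    max ((q 1 : ℝ) - q 0) 0 / ((1 + (q 0 : ℝ)) * (1 + (q 1 : ℝ))) := by
  have h := (charDim_sub_charDim q).2
  rcases le_total (q 0 : ℝ) (q 1) with h1 | h1
  · rw [charDim_neg_pos h1, sub_zero] at h
    rw [h, max_eq_left (by linarith)]
  · rw [charDim_pos_neg h1, max_eq_right (by linarith), zero_div]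

theorem charDim_neg_pos_eq (q : Param) : charDim q ![-1, 1] =
    max ((q 0 : ℝ) - q 1) 0 / ((1 + (q 0 : ℝ)) * (1 + (q 1 : ℝ))) := by
  have h := (charDim_sub_charDim q).2
  rcases le_total (q 0 : ℝ) (q 1) with h1 | h1
  · rw [charDim_neg_pos h1, max_eq_right (by linarith), zero_div]
  · rw [charDim_pos_neg h1, zero_sub, neg_eq_iff_eq_neg, ← neg_div, neg_sub] at h
    rw [h, max_eq_left (by linarith)]

theorem continuous_charDim (χ : Fin 2 → ℤˣ) : Continuous fun q => charDim q χ := by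
  have hχ : χ = ![χ 0, χ 1] := by ext i; fin_cases i <;> rfl
  have hc : ∀ i, Continuous fun q : Param => (q i : ℝ) := fun i =>
    continuous_subtype_val.comp (continuous_apply i)
  have h0 := hc 0
  have h1 := hc 1
  have hden : Continuous fun q : Param => (1 + (q 0 : ℝ)) * (1 + (q 1 : ℝ)) := by fun_prop
  have hne : ∀ q : Param, (1 + (q 0 : ℝ)) * (1 + (q 1 : ℝ)) ≠ 0 := fun q => (one_add_mul_pos q).ne'
  rw [hχ]
  rcases Int.units_eq_one_or (χ 0) with e | e <;> rcases Int.units_eq_one_or (χ 1) with e' | e' <;>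
    rw [e, e']
  · simp only [charDim_pos_pos_eq]
    exact Continuous.div (by fun_prop) hden hne
  · simp only [charDim_pos_neg_eq]
    exact Continuous.div (by fun_prop) hden hne
  · simp only [charDim_neg_pos_eq]
    exact Continuous.div (by fun_prop) hden hne
  · simp only [charDim_neg_neg_eq]
    exact Continuous.div (by fun_prop) hden hne

theorem rationalOn_of_eq {f : Param → ℝ} {A : Set Param} (α β γ : ℝ)
    (h : ∀ q ∈ A, f q = (α * (1 - (q 0 : ℝ) * q 1) + β * ((q 1 : ℝ) - q 0))
      / ((1 + (q 0 : ℝ)) * (1 + (q 1 : ℝ))) + γ) : RationalOn f A := by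
  refine ⟨MvPolynomial.C α * (1 - MvPolynomial.X 0 * MvPolynomial.X 1)
    + MvPolynomial.C β * (MvPolynomial.X 1 - MvPolynomial.X 0)
    + MvPolynomial.C γ * ((1 + MvPolynomial.X 0) * (1 + MvPolynomial.X 1)),
    (1 + MvPolynomial.X 0) * (1 + MvPolynomial.X 1), fun q hq => ?_⟩
  have hne := (one_add_mul_pos q).ne'
  simp only [map_add, map_mul, map_sub, map_one, MvPolynomial.eval_X, MvPolynomial.eval_C]
  refine ⟨hne, ?_⟩
  rw [h q hq, add_div _ (γ * _), mul_div_assoc γ, div_self hne, mul_one]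

end HeckeDihedral

end

open HeckeDihedral in
theorem mainTheorem3 {m n : ℕ}
    (M : Matrix (Fin m) (Fin n) (MonoidAlgebra ℝ HeckeDihedral.W)) :
    Continuous (dimKer M) ∧
    (RationalOn (dimKer M) {q | (q 0 : ℝ) * q 1 ≤ 1 ∧ (q 0 : ℝ) ≤ q 1} ∧
      RationalOn (dimKer M) {q | (q 0 : ℝ) * q 1 ≤ 1 ∧ (q 1 : ℝ) ≤ q 0} ∧
      RationalOn (dimKer M) {q | 1 ≤ (q 0 : ℝ) * q 1 ∧ (q 0 : ℝ) ≤ q 1} ∧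
      RationalOn (dimKer M) {q | 1 ≤ (q 0 : ℝ) * q 1 ∧ (q 1 : ℝ) ≤ q 0}) ∧
    ∃ a a' b b' c : ℕ, ∀ q : Param,
      dimKer M q =
        ((if (q 0 : ℝ) * q 1 < 1 then a else a' : ℕ) : ℝ) * dimG q (K q 1) +
        ((if (q 0 : ℝ) < q 1 then b else b' : ℕ) : ℝ) * dimG q (K q (-1)) +
        (c : ℝ) / 2 * dimG q (Kempty q) := by
  obtain ⟨c, hc⟩ := exists_dimKer_eq M
  set d : (Fin 2 → ℤˣ) → ℕ := fun χ => Module.finrank ℝ (charKer M χ) with hd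
  have hc' : ∀ q, dimKer M q = (d ![1, 1] * charDim q ![1, 1] + d ![1, -1] * charDim q ![1, -1]
      + d ![-1, 1] * charDim q ![-1, 1] + d ![-1, -1] * charDim q ![-1, -1])
      + (c : ℝ) / 2 * (1 - (charDim q ![1, 1] + charDim q ![1, -1] + charDim q ![-1, 1]
        + charDim q ![-1, -1])) := fun q => by
    rw [hc, sum_signs, sum_signs]
  refine ⟨?_, ⟨?_, ?_, ?_, ?_⟩, ?_⟩
  · have h := continuous_charDim
    simp only [funext hc]
    fun_prop
  · refine rationalOn_of_eq (d ![1, 1] - c / 2 : ℝ) (d ![1, -1] - c / 2 : ℝ) (c / 2 : ℝ) ?_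
    rintro q ⟨h1, h2⟩
    obtain ⟨e1, e2⟩ := charDim_sub_charDim q
    rw [charDim_neg_neg h1, sub_zero] at e1
    rw [charDim_neg_pos h2, sub_zero] at e2
    rw [hc', charDim_neg_neg h1, charDim_neg_pos h2, e1, e2]
    ring
  · refine rationalOn_of_eq (d ![1, 1] - c / 2 : ℝ) (-(d ![-1, 1] - c / 2) : ℝ) (c / 2 : ℝ) ?_
    rintro q ⟨h1, h2⟩
    obtain ⟨e1, e2⟩ := charDim_sub_charDim q
    rw [charDim_neg_neg h1, sub_zero] at e1
    rw [charDim_pos_neg h2, zero_sub, neg_eq_iff_eq_neg] at e2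
    rw [hc', charDim_neg_neg h1, charDim_pos_neg h2, e1, e2]
    ring
  · refine rationalOn_of_eq (-(d ![-1, -1] - c / 2) : ℝ) (d ![1, -1] - c / 2 : ℝ) (c / 2 : ℝ) ?_
    rintro q ⟨h1, h2⟩
    obtain ⟨e1, e2⟩ := charDim_sub_charDim q
    rw [charDim_pos_pos h1, zero_sub, neg_eq_iff_eq_neg] at e1
    rw [charDim_neg_pos h2, sub_zero] at e2
    rw [hc', charDim_pos_pos h1, charDim_neg_pos h2, e1, e2]
    ring
  · refine rationalOn_of_eq (-(d ![-1, -1] - c / 2) : ℝ) (-(d ![-1, 1] - c / 2) : ℝ) (c / 2 : ℝ) ?_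
    rintro q ⟨h1, h2⟩
    obtain ⟨e1, e2⟩ := charDim_sub_charDim q
    rw [charDim_pos_pos h1, zero_sub, neg_eq_iff_eq_neg] at e1
    rw [charDim_pos_neg h2, zero_sub, neg_eq_iff_eq_neg] at e2
    rw [hc', charDim_pos_pos h1, charDim_pos_neg h2, e1, e2]
    ring
  · refine ⟨d ![1, 1], d ![-1, -1], d ![1, -1], d ![-1, 1], c, fun q => ?_⟩
    rw [dimG_K_one, dimG_K_neg_one, dimG_Kempty, hc', sum_signs]
    have h1 : ((if (q 0 : ℝ) * q 1 < 1 then d ![1, 1] else d ![-1, -1] : ℕ) : ℝ)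
        * (charDim q ![1, 1] + charDim q ![-1, -1])
        = d ![1, 1] * charDim q ![1, 1] + d ![-1, -1] * charDim q ![-1, -1] := by
      split_ifs with h
      · rw [charDim_neg_neg h.le]; ring
      · rw [charDim_pos_pos (not_lt.1 h)]; ring
    have h2 : ((if (q 0 : ℝ) < q 1 then d ![1, -1] else d ![-1, 1] : ℕ) : ℝ)
        * (charDim q ![1, -1] + charDim q ![-1, 1])
        = d ![1, -1] * charDim q ![1, -1] + d ![-1, 1] * charDim q ![-1, 1] := by
      split_ifs with h
      · rw [charDim_neg_pos h.le]; ring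
      · rw [charDim_pos_neg (not_lt.1 h)]; ring
    rw [h1, h2]
    ring
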